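/- Let $p$ be a prime, $\mathbb{C}_p$ the completion of an algebraic closure of $\mathbb{Q}_p$ with $|p|=1/p$, and $k$ its residue field. Let $R_1<R_2<\cdots$ be real numbers with $R_1>p$ and $R_j\to\infty$, let $c=(c_j)_{j\ge 1}$ be a sequence in $\mathbb{C}_p$ with $|c_j|=R_j$ for all $j$, and put $$f_c(z)=\frac{z^p}{p}\prod_{j\ge 1}\Bigl(1-\frac{z}{c_j}\Bigr),\qquad \varphi(r)=\sup\{|f_c(z)| : |z|\le r\}.$$ Then $f_c$ is entire. Consider its action on the Berkovich affine line $\mathbb{A}^1_{an}$ (the multiplicative seminorms on $\mathbb{C}_p[z]$ extending the absolute value of $\mathbb{C}_p$), given by $|g(f_c(x))|=|(g\circ f_c)(x)|$ for $g\in\mathbb{C}_p[z]$. Let $B_0=\{x\in\mathbb{A}^1_{an} : |x|<1\}$ and $B_j=\{x\in\mathbb{A}^1_{an} : |x-c_j|<R_j\}$ for $j\ge 1$, where $|x-a|$ denotes the value of the seminorm $x$ at $z-a$. Let $\xi_{a,r}$ denote the sup-norm over the disk of center $a$ and radius $r$; it is of type II if $r\in|\mathbb{C}_p^\times|$. Let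 $\varrho=p^{-1/(p-1)}$. A fixed point $x$ is called repelling if either it is of type I (a point of $\mathbb{C}_p$) and its multiplier $\lambda=f_c'(x)$ satisfies $|\lambda|>1$, or it is not of type I and the local degree of $f_c$ at $x$ is at least $2$. The local degree at $x$ is the least number of solutions in $\mathbb{C}_p$, with multiplicity, of $f_c(z)=f_c(a)$ in a disk $|z-a|\le r$, taken over the $a\in\mathbb{C}_p$ and $r>0$ with $|x-a|\le r$. The following hold. 1. Every fixed point of $f_c$ in $\mathbb{A}^1_{an}$ lies in $B_j$ for some $j\ge 0$. 2. $B_0$ contains exactly one repelling fixed point, namely the type II point $w_0=\xi_{0,\varrho}$. The tangent map of $f_c$ at $w_0$ is the Frobenius morphism in a suitable coordinate: there are $a,b\in\mathbb{C}_p$, $b\ne 0$, with $w_0=\xi_{a,|b|}$ such that, if the set of directions at $w_0$ (the connected components of $\mathbb{A}^1_{an}\setminus\{w_0\}$) is identified with $\mathbb{P}^1(k)$ by letting the residue class of $w$, for $|w|\le 1$, correspond to the direction of $a+bw$ and $\infty$ to the direction of infinity, then the map induced by $f_c$ on directions is $t\mapsto t^p$, $\infty\mapsto\infty$. 3. For every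 $j\ge 1$, $B_j$ contains exactly one fixed point $w_j$ of $f_c$. It is a repelling fixed point of type I, and its multiplier $\lambda_j$ satisfies $|\lambda_j|=\varphi(R_j)/R_j$. -/

import Mathlib

open Polynomial Filter Topology

/-! ### Entire functions on `ℂ_[p]` -/

section Entire

variable {p : ℕ} [Fact p.Prime]

/-- `f` is the sum of a power series with infinite radius of convergence. -/
def IsEntire (f : ℂ_[p] → ℂ_[p]) : Prop :=
  ∃ P : FormalMultilinearSeries ℂ_[p] ℂ_[p] ℂ_[p], HasFPowerSeriesOnBall f P 0 ⊤

/-- The `n`-th Taylor coefficient of `f` at `a`. -/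
noncomputable def taylorCoeff (f : ℂ_[p] → ℂ_[p]) (a : ℂ_[p]) (n : ℕ) : ℂ_[p] :=
  (n.factorial : ℂ_[p])⁻¹ * iteratedDeriv n f a

/-- The Taylor polynomial of `f` at the origin, of degree less than `N`. -/
noncomputable def taylorPoly (f : ℂ_[p] → ℂ_[p]) (N : ℕ) : ℂ_[p][X] :=
  ∑ n ∈ Finset.range N, C (taylorCoeff f 0 n) * X ^ n

theorem HasFPowerSeriesOnBall.taylorCoeff_eq {f : ℂ_[p] → ℂ_[p]}
    {P : FormalMultilinearSeries ℂ_[p] ℂ_[p] ℂ_[p]} (h : HasFPowerSeriesOnBall f P 0 ⊤) (n : ℕ) :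
    taylorCoeff f 0 n = P.coeff n := by
  have h1 := h.factorial_smul 1 n
  rw [← iteratedDeriv_eq_iteratedFDeriv] at h1
  have h2 : (n.factorial : ℂ_[p]) ≠ 0 := by exact_mod_cast n.factorial_ne_zero
  rw [taylorCoeff, ← h1, FormalMultilinearSeries.coeff, nsmul_eq_mul, inv_mul_cancel_left₀ h2]
  rfl

theorem IsEntire.summable_norm {f : ℂ_[p] → ℂ_[p]} (hf : IsEntire f) {r : ℝ} (hr : 0 ≤ r) :
    Summable fun n => ‖taylorCoeff f 0 n‖ * r ^ n := by
  obtain ⟨P, hP⟩ := hf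
  have hrad : P.radius = ⊤ := top_le_iff.mp hP.r_le
  have h := P.summable_norm_mul_pow (r := ⟨r, hr⟩) (by rw [hrad]; exact ENNReal.coe_lt_top)
  refine h.congr fun n => ?_
  rw [hP.taylorCoeff_eq, P.norm_apply_eq_norm_coef]
  rfl

end Entire

/-! ### The Berkovich affine line -/

/-- The Berkovich affine line over `ℂ_[p]`: multiplicative seminorms on `ℂ_[p][X]` that extend
the absolute value of `ℂ_[p]`. -/
def BerkovichLine (p : ℕ) [Fact p.Prime] : Type :=
  {x : MulRingSeminorm ℂ_[p][X] // ∀ a : ℂ_[p], x (C a) = ‖a‖}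

namespace BerkovichLine

variable {p : ℕ} [Fact p.Prime]

/-- `x.eval g` is the value `|g(x)|` of the seminorm `x` at the polynomial `g`. -/
noncomputable def eval (x : BerkovichLine p) (g : ℂ_[p][X]) : ℝ := x.1 g

/-- The Gel'fand topology: the coarsest one for which every `x ↦ |g(x)|` is continuous. -/
noncomputable instance : TopologicalSpace (BerkovichLine p) :=
  TopologicalSpace.induced (fun x g => x.eval g) Pi.topologicalSpace

theorem eval_C (x : BerkovichLine p) (a : ℂ_[p]) : x.eval (C a) = ‖a‖ := x.2 a

theorem eval_mul (x : BerkovichLine p) (g h : ℂ_[p][X]) :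
    x.eval (g * h) = x.eval g * x.eval h := map_mul x.1 g h

theorem eval_pow (x : BerkovichLine p) (g : ℂ_[p][X]) (n : ℕ) :
    x.eval (g ^ n) = x.eval g ^ n := map_pow x.1 g n

theorem eval_add_le (x : BerkovichLine p) (g h : ℂ_[p][X]) :
    x.eval (g + h) ≤ x.eval g + x.eval h := map_add_le_add x.1 g h

theorem eval_neg (x : BerkovichLine p) (g : ℂ_[p][X]) :
    x.eval (-g) = x.eval g := map_neg_eq_map x.1 g

theorem eval_nonneg (x : BerkovichLine p) (g : ℂ_[p][X]) : 0 ≤ x.eval g := apply_nonneg x.1 g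

theorem eval_sum_le (x : BerkovichLine p) {ι : Type*} (s : Finset ι) (g : ι → ℂ_[p][X]) :
    x.eval (∑ i ∈ s, g i) ≤ ∑ i ∈ s, x.eval (g i) := by
  classical
  induction s using Finset.induction_on with
  | empty => simpa using (x.eval_C 0).le
  | insert i s hi ih =>
    rw [Finset.sum_insert hi, Finset.sum_insert hi]
    exact (x.eval_add_le _ _).trans (by gcongr)

theorem abs_eval_sub_eval_le (x : BerkovichLine p) (g h : ℂ_[p][X]) :
    |x.eval g - x.eval h| ≤ x.eval (g - h) := by
  have h1 := x.eval_add_le (g - h) h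
  have h2 := x.eval_add_le (-(g - h)) g
  rw [x.eval_neg] at h2
  simp only [sub_add_cancel, neg_sub] at h1 h2
  rw [abs_le]
  constructor <;> linarith

/-- A function with the properties of a multiplicative seminorm, as a point. -/
noncomputable def ofFun (F : ℂ_[p][X] → ℝ) (hC : ∀ a, F (C a) = ‖a‖) (hmul : ∀ g h, F (g * h) = F g * F h)
    (hadd : ∀ g h, F (g + h) ≤ F g + F h) : BerkovichLine p :=
  ⟨{ toFun := F
     map_zero' := by simpa using hC 0
     add_le' := hadd
     neg' := fun g => by
       have h := hmul (C (-1)) g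
       rw [hC] at h
       simpa using h
     map_one' := by simpa using hC 1
     map_mul' := hmul }, hC⟩

theorem eval_ofFun (F : ℂ_[p][X] → ℝ) (hC : ∀ a, F (C a) = ‖a‖)
    (hmul : ∀ g h, F (g * h) = F g * F h) (hadd : ∀ g h, F (g + h) ≤ F g + F h) (g : ℂ_[p][X]) :
    (ofFun F hC hmul hadd).eval g = F g := rfl

/-- The classical point `a`, that is, the seminorm `g ↦ ‖g(a)‖`. -/
noncomputable def classical (a : ℂ_[p]) : BerkovichLine p :=
  ofFun (fun g => ‖g.eval a‖) (fun b => by simp) (fun g h => by simp)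
    (fun g h => by simpa using norm_add_le _ _)

/-- The point `ξ_{a,r}`: the sup-norm over the disk of center `a` and radius `r`, given by its
value `max_n ‖b_n‖ r ^ n` on the polynomial `∑ n, b_n (X - a) ^ n`. -/
noncomputable def diskPoint (a : ℂ_[p]) (r : ℝ) (hr : 0 < r) : BerkovichLine p :=
  ofFun (fun g => (taylor a g).gaussNorm (NormedField.toAbsoluteValue ℂ_[p]) r)
    (fun b => by simp [NormedField.toAbsoluteValue])
    (fun g h => by
      rw [taylor_mul]
      exact gaussNorm_mul (PadicComplex.isNonarchimedean p) hr _ _)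
    (fun g h => by
      rw [map_add]
      have h1 := isNonarchimedean_gaussNorm (NormedField.toAbsoluteValue ℂ_[p])
        (PadicComplex.isNonarchimedean p) hr.le (taylor a g) (taylor a h)
      refine h1.trans (max_le_add_of_nonneg ?_ ?_) <;> exact gaussNorm_nonneg _ _ hr.le)

/-- The open disk `{x : |x - a| < r}`. -/
def openDisk (a : ℂ_[p]) (r : ℝ) : Set (BerkovichLine p) := {x | x.eval (X - C a) < r}

/-- Type I points. -/
def IsTypeI (x : BerkovichLine p) : Prop := ∃ a : ℂ_[p], x = classical a

/-- Type II points: the points of the closed disks of radius in the value group of `ℂ_[p]`. -/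
def IsTypeII (x : BerkovichLine p) : Prop :=
  ∃ (a b : ℂ_[p]) (hb : b ≠ 0), x = diskPoint a ‖b‖ (norm_pos_iff.mpr hb)

/-! ### The action of an entire function -/

theorem exists_eval_taylorPoly_sub_le {f : ℂ_[p] → ℂ_[p]} (hf : IsEntire f) (x : BerkovichLine p)
    (g : ℂ_[p][X]) :
    (∃ B, ∀ N, x.eval (g.comp (taylorPoly f N)) ≤ B) ∧
    ∀ ε > 0, ∃ N₀, ∀ M ≥ N₀, ∀ N ≥ N₀,
      x.eval (g.comp (taylorPoly f M) - g.comp (taylorPoly f N)) ≤ ε := by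
  have hs := hf.summable_norm (x.eval_nonneg X)
  have hterm : ∀ n, x.eval (C (taylorCoeff f 0 n) * X ^ n) =
      ‖taylorCoeff f 0 n‖ * x.eval X ^ n := fun n => by
    rw [eval_mul, eval_C, eval_pow]
  induction g using Polynomial.induction_on' with
  | add g h hg hh =>
    obtain ⟨⟨B, hB⟩, hg⟩ := hg
    obtain ⟨⟨B', hB'⟩, hh⟩ := hh
    refine ⟨⟨B + B', fun N => ?_⟩, fun ε hε => ?_⟩
    · rw [add_comp]
      exact (x.eval_add_le _ _).trans (add_le_add (hB N) (hB' N))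
    · obtain ⟨N₁, h₁⟩ := hg (ε / 2) (half_pos hε)
      obtain ⟨N₂, h₂⟩ := hh (ε / 2) (half_pos hε)
      refine ⟨max N₁ N₂, fun M hM N hN => ?_⟩
      rw [add_comp, add_comp, add_sub_add_comm]
      have := h₁ M (le_of_max_le_left hM) N (le_of_max_le_left hN)
      have := h₂ M (le_of_max_le_right hM) N (le_of_max_le_right hN)
      have := x.eval_add_le (g.comp (taylorPoly f M) - g.comp (taylorPoly f N))
        (h.comp (taylorPoly f M) - h.comp (taylorPoly f N))
      linarith
  | monomial k a =>
    set S := ∑' n, ‖taylorCoeff f 0 n‖ * x.eval X ^ n with hS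
    have hnn : ∀ n, 0 ≤ ‖taylorCoeff f 0 n‖ * x.eval X ^ n := fun n =>
      mul_nonneg (norm_nonneg _) (pow_nonneg (x.eval_nonneg X) n)
    have hbd : ∀ N, x.eval (taylorPoly f N) ≤ S := fun N => by
      refine (x.eval_sum_le _ _).trans ?_
      simp only [hterm]
      exact hs.sum_le_tsum _ fun n _ => hnn n
    have hS0 : 0 ≤ S := tsum_nonneg hnn
    have hcau : ∀ ε > 0, ∃ N₀, ∀ M ≥ N₀, ∀ N ≥ N₀,
        x.eval (taylorPoly f M - taylorPoly f N) ≤ ε := by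
      intro ε hε
      have ht := Metric.cauchySeq_iff.mp hs.hasSum.tendsto_sum_nat.cauchySeq ε hε
      obtain ⟨N₀, h₀⟩ := ht
      have key : ∀ N ≥ N₀, ∀ M ≥ N, x.eval (taylorPoly f M - taylorPoly f N) ≤ ε := by
        intro N hN M hM
        have h1 : taylorPoly f M - taylorPoly f N =
            ∑ n ∈ Finset.Ico N M, C (taylorCoeff f 0 n) * X ^ n := by
          rw [Finset.sum_Ico_eq_sub _ hM]; rfl
        have h2 := h₀ M (hN.le.trans hM) N hN
        rw [h1]
        refine (x.eval_sum_le _ _).trans ?_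
        simp only [hterm]
        rw [Finset.sum_Ico_eq_sub _ hM]
        exact (le_abs_self _).trans h2.le
      refine ⟨N₀, fun M hM N hN => ?_⟩
      rcases le_total N M with h | h
      · exact key N hN M h
      · rw [← x.eval_neg, neg_sub]
        exact key M hM N h
    refine ⟨⟨‖a‖ * S ^ k, fun N => ?_⟩, ?_⟩
    · rw [monomial_comp, eval_mul, eval_C, eval_pow]
      have := hbd N
      have := x.eval_nonneg (taylorPoly f N)
      gcongr
    · induction k with
      | zero =>
        intro ε hε
        refine ⟨0, fun M _ N _ => ?_⟩
        simpa [monomial_comp] using ((x.eval_C 0).trans norm_zero).le.trans hε.le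
      | succ k ih =>
        intro ε hε
        obtain ⟨N₁, h₁⟩ := ih (ε / 2 / (S + 1)) (by positivity)
        obtain ⟨N₂, h₂⟩ := hcau (ε / 2 / (‖a‖ * S ^ k + 1)) (by positivity)
        refine ⟨max N₁ N₂, fun M hM N hN => ?_⟩
        have e₁ := h₁ M (le_of_max_le_left hM) N (le_of_max_le_left hN)
        have e₂ := h₂ M (le_of_max_le_right hM) N (le_of_max_le_right hN)
        simp only [monomial_comp] at e₁ ⊢
        set u := taylorPoly f M
        set v := taylorPoly f N
        have hid : C a * u ^ (k + 1) - C a * v ^ (k + 1) =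
            (C a * u ^ k - C a * v ^ k) * u + (C a * v ^ k) * (u - v) := by ring
        rw [hid]
        refine (x.eval_add_le _ _).trans ?_
        rw [eval_mul, eval_mul, eval_mul _ (C a), eval_C, eval_pow]
        have hu : x.eval u ≤ S := hbd M
        have hv : x.eval v ≤ S := hbd N
        have hu0 := x.eval_nonneg u
        have hv0 := x.eval_nonneg v
        have a₁ : x.eval (C a * u ^ k - C a * v ^ k) * x.eval u ≤ ε / 2 / (S + 1) * (S + 1) :=
          mul_le_mul e₁ (hu.trans (by linarith)) hu0 (by positivity)
        have a₂ : ‖a‖ * x.eval v ^ k * x.eval (u - v) ≤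
            (‖a‖ * S ^ k + 1) * (ε / 2 / (‖a‖ * S ^ k + 1)) := by
          refine mul_le_mul ?_ e₂ (x.eval_nonneg _) (by positivity)
          have : ‖a‖ * x.eval v ^ k ≤ ‖a‖ * S ^ k := by gcongr
          linarith
        have b₁ : ε / 2 / (S + 1) * (S + 1) = ε / 2 := by field_simp
        have b₂ : (‖a‖ * S ^ k + 1) * (ε / 2 / (‖a‖ * S ^ k + 1)) = ε / 2 := by field_simp
        linarith

/-- The value at `x` of `g ∘ f`, for a polynomial `g` and an entire function `f`: the limit of
the values at `x` of the compositions of `g` with the Taylor polynomials of `f`. -/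
noncomputable def evalComp (f : ℂ_[p] → ℂ_[p]) (x : BerkovichLine p) (g : ℂ_[p][X]) : ℝ :=
  limUnder atTop fun N => x.eval (g.comp (taylorPoly f N))

theorem tendsto_evalComp {f : ℂ_[p] → ℂ_[p]} (hf : IsEntire f) (x : BerkovichLine p)
    (g : ℂ_[p][X]) :
    Tendsto (fun N => x.eval (g.comp (taylorPoly f N))) atTop (𝓝 (evalComp f x g)) := by
  refine CauchySeq.tendsto_limUnder (Metric.cauchySeq_iff.mpr fun ε hε => ?_)
  obtain ⟨N₀, h₀⟩ := (exists_eval_taylorPoly_sub_le hf x g).2 (ε / 2) (half_pos hε)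
  refine ⟨N₀, fun M hM N hN => ?_⟩
  have := h₀ M hM N hN
  have := x.abs_eval_sub_eval_le (g.comp (taylorPoly f M)) (g.comp (taylorPoly f N))
  rw [Real.dist_eq]
  linarith

/-- The action on the Berkovich affine line of an entire function `f`. -/
noncomputable def map {f : ℂ_[p] → ℂ_[p]} (hf : IsEntire f) (x : BerkovichLine p) :
    BerkovichLine p :=
  ofFun (evalComp f x)
    (fun a => tendsto_nhds_unique (tendsto_evalComp hf x (C a)) (by simp [eval_C]))
    (fun g h => tendsto_nhds_unique (tendsto_evalComp hf x (g * h)) (by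
      simpa only [mul_comp, eval_mul] using
        (tendsto_evalComp hf x g).mul (tendsto_evalComp hf x h)))
    (fun g h => le_of_tendsto_of_tendsto' (tendsto_evalComp hf x (g + h))
      ((tendsto_evalComp hf x g).add (tendsto_evalComp hf x h)) fun N => by
        rw [add_comp]; exact x.eval_add_le _ _)

theorem ext_eval {x y : BerkovichLine p} (h : ∀ g, x.eval g = y.eval g) : x = y :=
  Subtype.ext (DFunLike.ext _ _ h)

/-- The action on the Berkovich affine line extends the function on classical points. -/
theorem map_classical {f : ℂ_[p] → ℂ_[p]} (hf : IsEntire f) (z : ℂ_[p]) :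
    map hf (classical z) = classical (f z) := by
  refine ext_eval fun g => tendsto_nhds_unique (tendsto_evalComp hf (classical z) g) ?_
  have h1 : Tendsto (fun N => (taylorPoly f N).eval z) atTop (𝓝 (f z)) := by
    obtain ⟨P, hP⟩ := hf
    have h2 := (hP.hasSum (y := z) (by simp)).tendsto_sum_nat
    rw [zero_add] at h2
    refine h2.congr fun N => ?_
    rw [taylorPoly, eval_finsetSum]
    refine Finset.sum_congr rfl fun n _ => ?_
    rw [hP.taylorCoeff_eq, FormalMultilinearSeries.apply_eq_pow_smul_coeff]
    rw [Polynomial.eval_mul, Polynomial.eval_C, Polynomial.eval_pow, Polynomial.eval_X,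
      smul_eq_mul, mul_comm]
  have h3 : Tendsto (fun N => ‖g.eval ((taylorPoly f N).eval z)‖) atTop (𝓝 ‖g.eval (f z)‖) :=
    ((g.continuous.tendsto _).comp h1).norm
  refine h3.congr fun N => ?_
  show _ = ‖(g.comp (taylorPoly f N)).eval z‖
  rw [eval_comp]

end BerkovichLine

/-! ### Local degrees, repelling fixed points, tangent maps -/

/-- The Weierstrass degree of `f - f(a)` on the closed disk of center `a` and radius `r`: the
largest `n ≥ 1` for which `‖c_n‖ r ^ n` is maximal, where `c_n` are the Taylor coefficients of `f`
at `a`. For a nonconstant entire `f` it is the number of solutions, with multiplicity, of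
`f(z) = f(a)` in the disk. -/
noncomputable def weierstrassDegree {p : ℕ} [Fact p.Prime] (f : ℂ_[p] → ℂ_[p]) (a : ℂ_[p])
    (r : ℝ) : ℕ :=
  sSup {n : ℕ | 1 ≤ n ∧
    ∀ m : ℕ, 1 ≤ m → ‖taylorCoeff f a m‖ * r ^ m ≤ ‖taylorCoeff f a n‖ * r ^ n}

namespace BerkovichLine

variable {p : ℕ} [Fact p.Prime]

/-- The local degree of `f` at `x`: the smallest Weierstrass degree of `f` on the closed disks
`{y : |y - a| ≤ r}` that contain `x`. -/
noncomputable def localDegree (f : ℂ_[p] → ℂ_[p]) (x : BerkovichLine p) : ℕ :=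
  sInf {d : ℕ | ∃ (a : ℂ_[p]) (r : ℝ), 0 < r ∧ x.eval (X - C a) ≤ r ∧
    d = weierstrassDegree f a r}

/-- Repelling fixed points: the type I fixed points with multiplier of absolute value larger than
one, and the fixed points of type II, III or IV with local degree at least two. -/
def IsRepellingFixedPoint {f : ℂ_[p] → ℂ_[p]} (hf : IsEntire f) (x : BerkovichLine p) : Prop :=
  map hf x = x ∧
    ((∃ z lam : ℂ_[p], x = classical z ∧ HasDerivAt f lam z ∧ 1 < ‖lam‖) ∨
      (¬ x.IsTypeI ∧ 2 ≤ localDegree f x))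

/-- The directions at `x`: the connected components of the complement of `x`. -/
def directions (x : BerkovichLine p) : Set (Set (BerkovichLine p)) :=
  {D | ∃ y ∈ ({x}ᶜ : Set (BerkovichLine p)), D = connectedComponentIn {x}ᶜ y}

/-- `E` is the direction at `F x` that the tangent map of `F` at `x` assigns to the direction `D`
at `x`: all points of `D` close enough to `x` are mapped into `E`. -/
def IsTangentImage (F : BerkovichLine p → BerkovichLine p) (x : BerkovichLine p)
    (D E : Set (BerkovichLine p)) : Prop :=
  D ∈ directions x ∧ E ∈ directions (F x) ∧ ∃ U ∈ 𝓝 x, F '' (D ∩ U) ⊆ E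

/-- A coordinate on the tangent space at a type II point `x`, with `∞` the direction of infinity:
a bijection from the projective line over the residue field of `ℂ_[p]` onto the set of directions
at `x` that comes from an affine coordinate `z = a + b w` in which `x` is the Gauss point. -/
def IsTangentCoordinate (x : BerkovichLine p)
    (θ : OnePoint (IsLocalRing.ResidueField 𝓞_ℂ_[p]) → Set (BerkovichLine p)) : Prop :=
  Set.BijOn θ Set.univ (directions x) ∧
  ∃ (a b : ℂ_[p]) (hb : b ≠ 0), x = diskPoint a ‖b‖ (norm_pos_iff.mpr hb) ∧
    (∀ w : 𝓞_ℂ_[p], classical (a + b * (w : ℂ_[p])) ∈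
      θ ((IsLocalRing.residue 𝓞_ℂ_[p] w : IsLocalRing.ResidueField 𝓞_ℂ_[p]) :
        OnePoint (IsLocalRing.ResidueField 𝓞_ℂ_[p]))) ∧
    ∀ z : ℂ_[p], ‖b‖ < ‖z - a‖ → classical z ∈ θ OnePoint.infty

/-- The tangent map at a fixed point `x` of `F` is, in a suitable coordinate, the Frobenius
morphism `t ↦ t ^ p` of the projective line over the residue field of `ℂ_[p]`. -/
def TangentMapIsFrobenius (F : BerkovichLine p → BerkovichLine p) (x : BerkovichLine p) : Prop :=
  F x = x ∧ ∃ θ : OnePoint (IsLocalRing.ResidueField 𝓞_ℂ_[p]) → Set (BerkovichLine p),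
    IsTangentCoordinate x θ ∧
    (∀ (t : IsLocalRing.ResidueField 𝓞_ℂ_[p]) (E : Set (BerkovichLine p)),
      IsTangentImage F x (θ t) E ↔ E = θ ((t ^ p : IsLocalRing.ResidueField 𝓞_ℂ_[p]) :
        OnePoint (IsLocalRing.ResidueField 𝓞_ℂ_[p]))) ∧
    ∀ E : Set (BerkovichLine p), IsTangentImage F x (θ OnePoint.infty) E ↔ E = θ OnePoint.infty

end BerkovichLine

/-! ### The maps `f_c` -/

section Family

variable {p : ℕ} [Fact p.Prime]

/-- `f_c(z) = (z ^ p / p) ∏_{j ≥ 1} (1 - z / c_j)`, where `c_j` is written `c (j - 1)`. -/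
noncomputable def fc (c : ℕ → ℂ_[p]) (z : ℂ_[p]) : ℂ_[p] :=
  z ^ p / (p : ℂ_[p]) * ∏' j, (1 - z / c j)

/-- The maximum modulus `φ(r) = sup {|f(z)| : |z| ≤ r}`. -/
noncomputable def maxModulus (f : ℂ_[p] → ℂ_[p]) (r : ℝ) : ℝ :=
  sSup ((fun z => ‖f z‖) '' Metric.closedBall 0 r)

/-- `B_0 = {|x| < 1}`, and `B_j = {|x - c_j| < R_j}` for `j ≥ 1`, where `c_j` and `R_j` are written
`c (j - 1)` and `R (j - 1)`. -/
def block (c : ℕ → ℂ_[p]) (R : ℕ → ℝ) : ℕ → Set (BerkovichLine p)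
  | 0 => BerkovichLine.openDisk 0 1
  | j + 1 => BerkovichLine.openDisk (c j) (R j)

/-- `ϱ = p ^ (-1 / (p - 1))`. -/
noncomputable def rho (p : ℕ) : ℝ := (p : ℝ) ^ (-1 / ((p : ℝ) - 1))

theorem rho_pos (p : ℕ) [hp : Fact p.Prime] : 0 < rho p :=
  Real.rpow_pos_of_pos (by exact_mod_cast hp.out.pos) _

/-- The parameter space of sequences `c` with `|c_j| = R_j` for all `j`. -/
def paramSpace (p : ℕ) [Fact p.Prime] (R : ℕ → ℝ) : Set (ℕ → ℂ_[p]) := {c | ∀ j, ‖c j‖ = R j}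

theorem norm_prod_one_add_sub_one_le {ι : Type*} (s : Finset ι) (u : ι → ℂ_[p]) {e : ℝ}
    (he : 0 ≤ e) (he1 : e ≤ 1) (hu : ∀ i ∈ s, ‖u i‖ ≤ e) : ‖∏ i ∈ s, (1 + u i) - 1‖ ≤ e := by
  classical
  induction s using Finset.induction_on with
  | empty => simpa using he
  | insert i s hi ih =>
    rw [Finset.prod_insert hi]
    have h1 := ih fun j hj => hu j (Finset.mem_insert_of_mem hj)
    have h2 := hu i (Finset.mem_insert_self i s)
    have h3 : (1 + u i) * ∏ j ∈ s, (1 + u j) - 1 =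
        u i * (∏ j ∈ s, (1 + u j) - 1) + (u i + (∏ j ∈ s, (1 + u j) - 1)) := by ring
    rw [h3]
    refine (IsUltrametricDist.norm_add_le_max _ _).trans (max_le ?_ ?_)
    · rw [norm_mul]
      calc _ ≤ e * 1 := mul_le_mul h2 (h1.trans he1) (norm_nonneg _) he
        _ = e := mul_one e
    · exact (IsUltrametricDist.norm_add_le_max _ _).trans (max_le h2 h1)

/-- The product of `z ^ p / p` with the first `N` factors. -/
noncomputable def partialPoly (c : ℕ → ℂ_[p]) (N : ℕ) : ℂ_[p][X] :=
  C (p : ℂ_[p])⁻¹ * X ^ p * ∏ j ∈ Finset.range N, (1 - C (c j)⁻¹ * X)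

theorem exists_gaussNorm_partialPoly_le {c : ℕ → ℂ_[p]}
    (hc : Tendsto (fun j => ‖c j‖) atTop atTop) {r : ℝ} (hr : 0 < r) :
    ∃ M, 0 ≤ M ∧ (∀ N i, ‖(partialPoly c N).coeff i‖ * r ^ i ≤ M) ∧
      ∀ N i, ‖(partialPoly c (N + 1)).coeff i - (partialPoly c N).coeff i‖ * r ^ i ≤
        M * (r / ‖c N‖) := by
  set v := NormedField.toAbsoluteValue ℂ_[p]
  have hv : ∀ a, v a = ‖a‖ := fun a => rfl
  have hna : IsNonarchimedean v := PadicComplex.isNonarchimedean p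
  have hlin : ∀ j, gaussNorm v r (C (c j)⁻¹ * X) = r / ‖c j‖ := fun j => by
    rw [← monomial_one_one_eq_X, C_mul_monomial, gaussNorm_monomial, hv]
    simp [div_eq_inv_mul]
  have hfac : ∀ j, gaussNorm v r (1 - C (c j)⁻¹ * X) ≤ max 1 (r / ‖c j‖) := fun j => by
    have h1 := isNonarchimedean_gaussNorm v hna hr.le 1 (C (-(c j)⁻¹) * X)
    have h2 : gaussNorm v r (C (-(c j)⁻¹) * X) = r / ‖c j‖ := by
      rw [← monomial_one_one_eq_X, C_mul_monomial, gaussNorm_monomial, hv]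
      simp [div_eq_inv_mul]
    have h3 : gaussNorm v r (1 : ℂ_[p][X]) = 1 := by
      rw [← C_1, gaussNorm_C, hv, norm_one]
    rw [h2, h3] at h1
    rwa [C_neg, neg_mul, ← sub_eq_add_neg] at h1
  obtain ⟨N₀, hN₀⟩ := eventually_atTop.mp (hc.eventually_ge_atTop r)
  set A := gaussNorm v r (C (p : ℂ_[p])⁻¹ * X ^ p : ℂ_[p][X])
  have hA : 0 ≤ A := gaussNorm_nonneg _ _ hr.le
  have hP : ∀ N, ∏ j ∈ Finset.range N, max 1 (r / ‖c j‖) ≤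
      ∏ j ∈ Finset.range N₀, max 1 (r / ‖c j‖) := fun N => by
    rcases le_total N N₀ with h | h
    · rw [← Finset.prod_sdiff (Finset.range_mono h)]
      refine le_mul_of_one_le_left
        (Finset.prod_nonneg fun j _ => zero_le_one.trans (le_max_left _ _)) ?_
      exact Finset.prod_induction _ (fun x : ℝ => 1 ≤ x)
        (fun a b => one_le_mul_of_one_le_of_one_le) le_rfl fun j _ => le_max_left _ _
    · refine (Finset.prod_subset (Finset.range_mono h) fun j _ hj => ?_).ge
      have h2 := hN₀ j (by simpa using hj)
      exact max_eq_left ((div_le_one (hr.trans_le h2)).mpr h2)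
  set M := A * ∏ j ∈ Finset.range N₀, max 1 (r / ‖c j‖)
  have hM : ∀ N, gaussNorm v r (partialPoly c N) ≤ M := fun N => by
    have h1 : gaussNorm v r (∏ j ∈ Finset.range N, (1 - C (c j)⁻¹ * X)) ≤
        ∏ j ∈ Finset.range N, max 1 (r / ‖c j‖) := by
      induction N with
      | zero =>
        rw [Finset.prod_range_zero, Finset.prod_range_zero, ← C_1, gaussNorm_C, hv, norm_one]
      | succ N ih =>
        rw [Finset.prod_range_succ, Finset.prod_range_succ, gaussNorm_mul hna hr]
        exact mul_le_mul ih (hfac N) (gaussNorm_nonneg _ _ hr.le)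
          (Finset.prod_nonneg fun j _ => zero_le_one.trans (le_max_left _ _))
    rw [partialPoly, gaussNorm_mul hna hr]
    exact mul_le_mul_of_nonneg_left (h1.trans (hP N)) hA
  refine ⟨M, (gaussNorm_nonneg _ _ hr.le).trans (hM 0), fun N i =>
    (le_gaussNorm v _ hr.le i).trans (hM N), fun N i => ?_⟩
  have h1 : partialPoly c (N + 1) - partialPoly c N =
      partialPoly c N * (C (-1) * (C (c N)⁻¹ * X)) := by
    rw [partialPoly, partialPoly, Finset.prod_range_succ, C_neg, C_1]
    ring
  rw [← coeff_sub, h1]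
  refine (le_gaussNorm v _ hr.le i).trans ?_
  rw [gaussNorm_mul hna hr, gaussNorm_mul hna hr, hlin, gaussNorm_C, hv, norm_neg,
    norm_one, one_mul]
  exact mul_le_mul_of_nonneg_right (hM N) (by positivity)

theorem multipliable_one_sub_div {c : ℕ → ℂ_[p]} (hc : Tendsto (fun j => ‖c j‖) atTop atTop)
    (z : ℂ_[p]) : Multipliable fun j => 1 - z / c j := by
  have hlim : Tendsto (fun j => ‖-(z / c j)‖) atTop (𝓝 0) := by
    simp only [norm_neg, norm_div]
    exact hc.const_div_atTop ‖z‖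
  set u : ℕ → ℂ_[p] := fun j => -(z / c j) with hu
  have hfac : ∀ j, 1 - z / c j = 1 + u j := fun j => by rw [hu, sub_eq_add_neg]
  simp only [hfac]
  obtain ⟨N₀, hN₀⟩ := eventually_atTop.mp (hlim.eventually (ge_mem_nhds one_pos))
  set B := ‖∏ j ∈ Finset.range N₀, (1 + u j)‖ with hB
  have hbd : ∀ N ≥ N₀, ‖∏ j ∈ Finset.range N, (1 + u j)‖ ≤ B := fun N hN => by
    induction N, hN using Nat.le_induction with
    | base => exact le_rfl
    | succ N hN ih =>
      rw [Finset.prod_range_succ, norm_mul]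
      have h1 : ‖1 + u N‖ ≤ 1 :=
        (IsUltrametricDist.norm_add_le_max _ _).trans (max_le norm_one.le (hN₀ N hN))
      exact (mul_le_of_le_one_right (norm_nonneg _) h1).trans ih
  have hcau : CauchySeq fun s : Finset ℕ => ∏ j ∈ s, (1 + u j) := by
    refine Metric.cauchySeq_iff'.mpr fun ε hε => ?_
    have hB0 : 0 ≤ B := norm_nonneg _
    set e := min 1 (ε / 2 / (B + 1)) with he
    have he0 : 0 < e := lt_min one_pos (by positivity)
    obtain ⟨N₁, hN₁⟩ := eventually_atTop.mp (hlim.eventually (ge_mem_nhds he0))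
    refine ⟨Finset.range (max N₀ N₁), fun s hs => ?_⟩
    have h1 := norm_prod_one_add_sub_one_le (s \ Finset.range (max N₀ N₁)) u he0.le
      (min_le_left _ _) fun j hj => hN₁ j (by
        have := (Finset.mem_sdiff.mp hj).2
        rw [Finset.mem_range, not_lt] at this
        exact le_of_max_le_right this)
    have h2 : ∏ j ∈ s, (1 + u j) - ∏ j ∈ Finset.range (max N₀ N₁), (1 + u j) =
        (∏ j ∈ Finset.range (max N₀ N₁), (1 + u j)) *
          (∏ j ∈ s \ Finset.range (max N₀ N₁), (1 + u j) - 1) := by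
      rw [← Finset.prod_sdiff hs]
      ring
    rw [dist_eq_norm, h2, norm_mul]
    calc _ ≤ (B + 1) * (ε / 2 / (B + 1)) :=
          mul_le_mul ((hbd _ (le_max_left _ _)).trans (by linarith))
            (h1.trans (min_le_right _ _)) (norm_nonneg _) (by positivity)
      _ = ε / 2 := by field_simp
      _ < ε := by linarith
  obtain ⟨l, hl⟩ := cauchySeq_tendsto_of_complete hcau
  exact ⟨l, by simpa [HasProd] using hl⟩

/-- The map `f_c` is entire when `|c_j|` tends to infinity. -/
theorem fc_isEntire {c : ℕ → ℂ_[p]} (hc : Tendsto (fun j => ‖c j‖) atTop atTop) :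
    IsEntire (fc c) := by
  -- uniform estimate on the tails of the coefficients
  have htail : ∀ r : ℝ, 0 < r → ∀ ε > 0, ∃ N₀, ∀ N ≥ N₀, ∀ M ≥ N, ∀ i,
      ‖(partialPoly c M).coeff i - (partialPoly c N).coeff i‖ * r ^ i ≤ ε := by
    intro r hr ε hε
    obtain ⟨K, hK0, -, hK⟩ := exists_gaussNorm_partialPoly_le hc hr
    have h1 : Tendsto (fun j => K * (r / ‖c j‖)) atTop (𝓝 0) := by
      simpa using (hc.const_div_atTop r).const_mul K
    obtain ⟨N₀, hN₀⟩ := eventually_atTop.mp (h1.eventually (ge_mem_nhds hε))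
    refine ⟨N₀, fun N hN M hM i => ?_⟩
    induction M, hM using Nat.le_induction with
    | base => simpa using hε.le
    | succ M hM ih =>
      have h2 := (hK M i).trans (hN₀ M (hN.le.trans hM))
      have h3 : (partialPoly c (M + 1)).coeff i - (partialPoly c N).coeff i =
          ((partialPoly c (M + 1)).coeff i - (partialPoly c M).coeff i) +
            ((partialPoly c M).coeff i - (partialPoly c N).coeff i) := by ring
      rw [h3]
      refine (mul_le_mul_of_nonneg_right (IsUltrametricDist.norm_add_le_max _ _)
        (by positivity)).trans ?_
      rw [max_mul_of_nonneg _ _ (by positivity)]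
      exact max_le h2 ih
  have hq : ∀ i, ∃ q, Tendsto (fun N => (partialPoly c N).coeff i) atTop (𝓝 q) := fun i => by
    refine cauchySeq_tendsto_of_complete (Metric.cauchySeq_iff'.mpr fun ε hε => ?_)
    obtain ⟨N₀, h₀⟩ := htail 1 one_pos (ε / 2) (half_pos hε)
    refine ⟨N₀, fun N hN => ?_⟩
    have := h₀ N₀ le_rfl N hN i
    rw [one_pow, mul_one] at this
    rw [dist_eq_norm]
    linarith
  choose q hq using hq
  set P := FormalMultilinearSeries.ofScalars ℂ_[p] q
  have hcoeff : ∀ i, P.coeff i = q i := fun i => FormalMultilinearSeries.coeff_ofScalars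
  have hrad : P.radius = ⊤ := by
    refine ENNReal.eq_top_of_forall_nnreal_le fun r => ?_
    refine le_trans ?_ (P.le_radius_of_bound
      (r := r + 1) (exists_gaussNorm_partialPoly_le hc (r := (r : ℝ) + 1) (by positivity)).choose
      fun i => ?_)
    · exact_mod_cast le_self_add
    · have h1 := (exists_gaussNorm_partialPoly_le hc (r := (r : ℝ) + 1)
        (by positivity)).choose_spec.2.1
      rw [P.norm_apply_eq_norm_coef, hcoeff]
      exact le_of_tendsto' ((hq i).norm.mul_const _) fun N => h1 N i
  have hball : HasFPowerSeriesOnBall P.sum P 0 ⊤ := by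
    have := P.hasFPowerSeriesOnBall (by rw [hrad]; exact ENNReal.zero_lt_top)
    rwa [hrad] at this
  suffices h : P.sum = fc c from ⟨P, h ▸ hball⟩
  funext z
  -- the partial products converge to the sum of the power series
  have hsum : HasSum (fun i => q i * z ^ i) (P.sum z) := by
    have := hball.hasSum (y := z) (by simp)
    rw [zero_add] at this
    refine this.congr_fun fun i => ?_
    rw [FormalMultilinearSeries.apply_eq_pow_smul_coeff, hcoeff, smul_eq_mul, mul_comm]
  have hlim : Tendsto (fun N => (partialPoly c N).eval z) atTop (𝓝 (P.sum z)) := by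
    refine Metric.tendsto_atTop.mpr fun ε hε => ?_
    obtain ⟨N₀, h₀⟩ := htail (‖z‖ + 1) (by positivity) (ε / 2) (half_pos hε)
    refine ⟨N₀, fun N hN => ?_⟩
    have h1 : HasSum (fun i => (partialPoly c N).coeff i * z ^ i) ((partialPoly c N).eval z) := by
      rw [Polynomial.eval_eq_sum_range]
      refine hasSum_sum_of_ne_finset_zero fun i hi => ?_
      rw [coeff_eq_zero_of_natDegree_lt (by simpa using hi), zero_mul]
    have h2 : ∀ i, ‖q i * z ^ i - (partialPoly c N).coeff i * z ^ i‖ ≤ ε / 2 := fun i => by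
      rw [← sub_mul, norm_mul, norm_pow]
      refine (mul_le_mul_of_nonneg_left (pow_le_pow_left₀ (norm_nonneg z)
        (le_add_of_nonneg_right zero_le_one) i) (norm_nonneg _)).trans ?_
      exact le_of_tendsto (((hq i).sub_const _).norm.mul_const _)
        (eventually_atTop.mpr ⟨N, fun M hM => h₀ N hN M hM i⟩)
    have h3 : ‖P.sum z - (partialPoly c N).eval z‖ ≤ ε / 2 := by
      refine le_of_tendsto' (hsum.sub h1).tendsto_sum_nat.norm fun m => ?_
      exact IsUltrametricDist.norm_sum_le_of_forall_le_of_nonneg (half_pos hε).le fun i _ => h2 i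
    rw [dist_comm, dist_eq_norm]
    linarith
  refine tendsto_nhds_unique hlim ?_
  have h1 := ((multipliable_one_sub_div hc z).hasProd.tendsto_prod_nat).const_mul
    (z ^ p / (p : ℂ_[p]))
  refine h1.congr fun N => ?_
  rw [partialPoly, Polynomial.eval_mul, Polynomial.eval_prod]
  simp [div_eq_inv_mul]

theorem tendsto_norm_of_mem_paramSpace {R : ℕ → ℝ} (hR : Tendsto R atTop atTop) {c : ℕ → ℂ_[p]}
    (hc : c ∈ paramSpace p R) : Tendsto (fun j => ‖c j‖) atTop atTop :=
  hR.congr fun j => (hc j).symm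

end Family

/-! The zeros of `f_c` are 0, with multiplicity p, and the simple zeros c_j, whose absolute values
are distinct. Hence |f_c(x)| = p |x|^p ∏ |x - c_j| / |c_j| on the Berkovich line, and the three
claims are read off this product. If |x| ≥ 1 and |x - c_j| ≥ R_j for all j, then |f_c(x)| ≥ p |x|^p
> |x|, so every fixed point lies in a block (`exists_mem_of_map_eq`).

In B_0 all factors have value 1, so |f_c(x)| = p |x|^p (`map_eval_X`) and a fixed point has |x| = 0
or |x| = ϱ. For |a| ≤ ϱ and s = |x - a| ≤ ϱ one has |f_c(x) - f_c(a)| ≤ s max(p s^(p-1), 1/p)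
(`map_eval_sub_le`), a strict contraction when 0 < s < ϱ. A fixed point with |x| = ϱ other than
ξ_{0,ϱ} lies in some open disk of radius ϱ. Iterating the contraction puts it in arbitrarily small
disks, so it is of type I (`isTypeI_or_eq_of_map_eq`), and its multiplier is at most 1 in absolute
value. At ξ_{0,ϱ} the map is z^p / p up to an error smaller than ϱ, which in the coordinate z = b w
with b^(p-1) = p reduces to Frobenius. The local degree there is at least 2 because `f_c` has no
linear term at 0.

In B_j write f_c = -(z - c_j) q / c_j. There |q| is constant, equal to φ(R_j), and the relative
variation of q between x and a is at most |x - a| / R_j. So `f_c` multiplies distances by exactly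
φ(R_j) / R_j > 1 (`map_eval_sub_eq`). This gives the multiplier and the uniqueness of the fixed
point. For existence, the partial products have fixed points in B_j by a root count, and expansion
makes these approximate fixed points of `f_c` converge (`exists_fixedPoint`).

Two reductions make this work for seminorms: a point is determined by its values at linear
polynomials, since ℂ_p is algebraically closed (`ext_linear`), and the action of `f_c` is the limit
of the partial products (`tendsto_eval_partialPoly_sub`). -/

namespace BerkovichLine

variable {p : ℕ} [Fact p.Prime]

/-! ### Multiplicative seminorms on polynomials -/

theorem eval_one (x : BerkovichLine p) : x.eval 1 = 1 := map_one x.1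

theorem eval_zero (x : BerkovichLine p) : x.eval 0 = 0 := map_zero x.1

theorem eval_natCast_le (x : BerkovichLine p) (n : ℕ) : x.eval (n : ℂ_[p][X]) ≤ 1 := by
  rw [← C_eq_natCast, eval_C]
  exact IsUltrametricDist.norm_natCast_le_one ℂ_[p] n

theorem eval_natCast_mul_le (x : BerkovichLine p) (n : ℕ) (g : ℂ_[p][X]) :
    x.eval (n * g) ≤ x.eval g := by
  rw [eval_mul]
  exact mul_le_of_le_one_left (x.eval_nonneg _) (x.eval_natCast_le n)

theorem eval_prod (x : BerkovichLine p) {ι : Type*} (s : Finset ι) (g : ι → ℂ_[p][X]) :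
    x.eval (∏ i ∈ s, g i) = ∏ i ∈ s, x.eval (g i) := map_prod x.1 g s

theorem eval_sub_comm (x : BerkovichLine p) (g h : ℂ_[p][X]) :
    x.eval (g - h) = x.eval (h - g) := by rw [← neg_sub, eval_neg]

/-- Multiplicative seminorms extending the absolute value of `ℂ_[p]` are nonarchimedean. -/
theorem eval_add_le_max (x : BerkovichLine p) (g h : ℂ_[p][X]) :
    x.eval (g + h) ≤ max (x.eval g) (x.eval h) := by
  by_contra! hlt
  obtain ⟨m, hm, hmu⟩ := exists_between hlt
  have hM0 : 0 ≤ max (x.eval g) (x.eval h) := le_max_of_le_left (x.eval_nonneg g)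
  have hm0 : 0 < m := hM0.trans_lt hm
  set u := x.eval (g + h)
  -- Binomial theorem: integers have value at most 1, so each of the n + 1 terms is at most m ^ n.
  -- The linear factor n + 1 cannot keep up with (u / m) ^ n.
  have hbound : ∀ n : ℕ, u ^ n ≤ (n + 1) * m ^ n := fun n => by
    rw [← eval_pow, add_pow]
    refine (x.eval_sum_le _ _).trans ?_
    have : ∀ k ∈ Finset.range (n + 1),
        x.eval (g ^ k * h ^ (n - k) * (n.choose k : ℂ_[p][X])) ≤ m ^ n := fun k hk => by
      rw [mul_comm]
      refine (x.eval_natCast_mul_le _ _).trans ?_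
      rw [eval_mul, eval_pow, eval_pow]
      have hk' : k + (n - k) = n := by have := Finset.mem_range.mp hk; omega
      conv_rhs => rw [← hk', pow_add]
      have := x.eval_nonneg g
      have := x.eval_nonneg h
      gcongr
      · exact (le_max_left _ _).trans hm.le
      · exact (le_max_right _ _).trans hm.le
    refine (Finset.sum_le_card_nsmul _ _ _ this).trans ?_
    simp
  have hr : 1 < u / m := (one_lt_div hm0).mpr hmu
  have h1 := (tendsto_pow_const_div_const_pow_of_one_lt 1 hr).add
    (tendsto_pow_const_div_const_pow_of_one_lt 0 hr)
  simp only [pow_one, pow_zero, add_zero] at h1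
  obtain ⟨n, hn⟩ := (h1.eventually (gt_mem_nhds one_pos)).exists
  have hrn : 0 < (u / m) ^ n := pow_pos (one_pos.trans hr) n
  rw [← add_div, div_lt_one hrn, div_pow, lt_div_iff₀ (pow_pos hm0 n)] at hn
  exact absurd (hbound n) (not_le.mpr hn)

theorem eval_sub_le_max (x : BerkovichLine p) (g h : ℂ_[p][X]) :
    x.eval (g - h) ≤ max (x.eval g) (x.eval h) := by
  rw [sub_eq_add_neg, ← x.eval_neg h]
  exact x.eval_add_le_max g (-h)

theorem eval_sub_le_max_sub (x : BerkovichLine p) (g h k : ℂ_[p][X]) :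
    x.eval (g - k) ≤ max (x.eval (g - h)) (x.eval (h - k)) := by
  simpa using x.eval_add_le_max (g - h) (h - k)

theorem eval_add_eq_left (x : BerkovichLine p) {g h : ℂ_[p][X]} (hlt : x.eval h < x.eval g) :
    x.eval (g + h) = x.eval g := by
  refine le_antisymm ((x.eval_add_le_max g h).trans (max_le le_rfl hlt.le)) ?_
  have h1 := x.eval_sub_le_max (g + h) h
  rw [add_sub_cancel_right] at h1
  exact (le_max_iff.mp h1).resolve_right (not_le.mpr hlt)

theorem eval_sub_eq_left (x : BerkovichLine p) {g h : ℂ_[p][X]} (hlt : x.eval h < x.eval g) :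
    x.eval (g - h) = x.eval g := by
  rw [sub_eq_add_neg]
  exact x.eval_add_eq_left (by rwa [eval_neg])

theorem eval_sub_eq_right (x : BerkovichLine p) {g h : ℂ_[p][X]} (hlt : x.eval g < x.eval h) :
    x.eval (g - h) = x.eval h := by
  rw [eval_sub_comm, eval_sub_eq_left x hlt]

theorem eval_sum_le_of_le (x : BerkovichLine p) {ι : Type*} (s : Finset ι) (g : ι → ℂ_[p][X])
    {B : ℝ} (hB : 0 ≤ B) (h : ∀ i ∈ s, x.eval (g i) ≤ B) : x.eval (∑ i ∈ s, g i) ≤ B := by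
  classical
  induction s using Finset.induction_on with
  | empty => simpa [eval_zero] using hB
  | insert i s hi ih =>
    rw [Finset.sum_insert hi]
    exact (x.eval_add_le_max _ _).trans (max_le (h i (Finset.mem_insert_self i s))
      (ih fun j hj => h j (Finset.mem_insert_of_mem hj)))

/-- Two products are as close as their factors, relatively to bounds for the factors. -/
theorem eval_prod_sub_prod_le (x : BerkovichLine p) {ι : Type*} (s : Finset ι)
    (g h : ι → ℂ_[p][X]) {B : ι → ℝ} {e : ℝ} (he : 0 ≤ e) (hg : ∀ i ∈ s, x.eval (g i) ≤ B i)
    (hh : ∀ i ∈ s, x.eval (h i) ≤ B i) (hgh : ∀ i ∈ s, x.eval (g i - h i) ≤ e * B i) :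
    x.eval (∏ i ∈ s, g i - ∏ i ∈ s, h i) ≤ e * ∏ i ∈ s, B i := by
  classical
  induction s using Finset.induction_on with
  | empty => simpa [eval_zero] using he
  | insert i s hi ih =>
    rw [Finset.prod_insert hi, Finset.prod_insert hi, Finset.prod_insert hi]
    have hid : g i * ∏ j ∈ s, g j - h i * ∏ j ∈ s, h j =
        g i * (∏ j ∈ s, g j - ∏ j ∈ s, h j) + (g i - h i) * ∏ j ∈ s, h j := by ring
    have ih' := ih (fun j hj => hg j (Finset.mem_insert_of_mem hj))
      (fun j hj => hh j (Finset.mem_insert_of_mem hj))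
      (fun j hj => hgh j (Finset.mem_insert_of_mem hj))
    have h1 := hg i (Finset.mem_insert_self i s)
    have h2 := hgh i (Finset.mem_insert_self i s)
    have hB : ∀ j ∈ insert i s, 0 ≤ B j := fun j hj => (x.eval_nonneg _).trans (hg j hj)
    have hBi := hB i (Finset.mem_insert_self i s)
    rw [hid]
    refine (x.eval_add_le_max _ _).trans (max_le ?_ ?_)
    · rw [eval_mul]
      calc _ ≤ B i * (e * ∏ j ∈ s, B j) := mul_le_mul h1 ih' (x.eval_nonneg _) hBi
        _ = _ := by ring
    · rw [eval_mul, eval_prod]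
      calc _ ≤ (e * B i) * ∏ j ∈ s, B j :=
            mul_le_mul h2 (Finset.prod_le_prod (fun j _ => x.eval_nonneg _)
              fun j hj => hh j (Finset.mem_insert_of_mem hj))
              (Finset.prod_nonneg fun j _ => x.eval_nonneg _) (mul_nonneg he hBi)
        _ = _ := by ring

theorem eval_C_sub_C (x : BerkovichLine p) (a b : ℂ_[p]) : x.eval (C a - C b) = ‖a - b‖ := by
  rw [← C_sub, eval_C]

theorem eval_X_sub_C_le (x : BerkovichLine p) (a b : ℂ_[p]) :
    x.eval (X - C b) ≤ max (x.eval (X - C a)) ‖a - b‖ := by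
  rw [← x.eval_C_sub_C]
  exact x.eval_sub_le_max_sub _ _ _

theorem norm_sub_le_max (x : BerkovichLine p) (a b : ℂ_[p]) :
    ‖a - b‖ ≤ max (x.eval (X - C a)) (x.eval (X - C b)) := by
  rw [← x.eval_C_sub_C, x.eval_sub_comm X (C a)]
  exact x.eval_sub_le_max_sub _ _ _

theorem norm_le_max (x : BerkovichLine p) (a : ℂ_[p]) :
    ‖a‖ ≤ max (x.eval (X - C a)) (x.eval X) := by
  simpa using x.norm_sub_le_max a 0

/-! ### Points are determined by their values at linear polynomials -/

/-- Since ℂ_p is algebraically closed and x is multiplicative, linear polynomials carry all the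
information. Equality of points and continuity are tested on them from here on. -/
theorem eval_eq_prod_roots (x : BerkovichLine p) (g : ℂ_[p][X]) :
    x.eval g = ‖g.leadingCoeff‖ * (g.roots.map fun a => x.eval (X - C a)).prod := by
  conv_lhs => rw [(IsAlgClosed.splits g).eq_prod_roots]
  rw [eval_mul, eval_C]
  congr 1
  change x.1 _ = _
  rw [map_multiset_prod, Multiset.map_map]
  rfl

theorem ext_linear {x y : BerkovichLine p}
    (h : ∀ a, x.eval (X - C a) = y.eval (X - C a)) : x = y :=
  ext_eval fun g => by rw [eval_eq_prod_roots, eval_eq_prod_roots y]; simp only [h]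

theorem classical_eval (a : ℂ_[p]) (g : ℂ_[p][X]) : (classical a).eval g = ‖g.eval a‖ := rfl

theorem classical_eval_X_sub_C (a b : ℂ_[p]) : (classical a).eval (X - C b) = ‖a - b‖ := by
  simp [classical_eval]

theorem eq_classical {x : BerkovichLine p} {a : ℂ_[p]} (h : x.eval (X - C a) = 0) :
    x = classical a := by
  refine ext_linear fun b => ?_
  rw [classical_eval_X_sub_C]
  refine le_antisymm ((x.eval_X_sub_C_le a b).trans ?_) ((x.norm_sub_le_max a b).trans ?_) <;>
    simp [h, x.eval_nonneg]

theorem diskPoint_eval_X_sub_C (a b : ℂ_[p]) {r : ℝ} (hr : 0 < r) :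
    (diskPoint a r hr).eval (X - C b) = max ‖a - b‖ r := by
  have h0 : taylor a (X - C b) = X + C (a - b) := by
    rw [map_sub, taylor_X, taylor_C, C_sub, add_sub_assoc]
  set v := NormedField.toAbsoluteValue ℂ_[p]
  have hX : gaussNorm v r (X : ℂ_[p][X]) = r := by
    rw [← monomial_one_one_eq_X, gaussNorm_monomial, map_one, one_mul, pow_one]
  have hC : gaussNorm v r (C (a - b)) = ‖a - b‖ := gaussNorm_C v r _
  change gaussNorm v r (taylor a (X - C b)) = _
  rw [h0]
  refine le_antisymm ?_ (max_le ?_ ?_)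
  · have h1 := isNonarchimedean_gaussNorm v (PadicComplex.isNonarchimedean p) hr.le X (C (a - b))
    rwa [hX, hC, max_comm] at h1
  · have h1 := le_gaussNorm v (X + C (a - b) : ℂ_[p][X]) hr.le 0
    rwa [coeff_add, coeff_X_zero, coeff_C_zero, zero_add, pow_zero, mul_one] at h1
  · have h1 := le_gaussNorm v (X + C (a - b) : ℂ_[p][X]) hr.le 1
    rwa [coeff_add, coeff_X_one, coeff_C_succ, add_zero, map_one, pow_one, one_mul] at h1

theorem continuous_eval (g : ℂ_[p][X]) : Continuous fun x : BerkovichLine p => x.eval g :=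
  (continuous_apply g).comp continuous_induced_dom

theorem continuous_of_linear {Z : Type*} [TopologicalSpace Z] {φ : Z → BerkovichLine p}
    (h : ∀ a, Continuous fun z => (φ z).eval (X - C a)) : Continuous φ := by
  refine continuous_induced_rng.mpr (continuous_pi fun g => ?_)
  change Continuous fun z => (φ z).eval g
  simp only [eval_eq_prod_roots _ g]
  exact continuous_const.mul (continuous_multiset_prod _ fun a _ => h a)

/-- The point `ξ_{a,t}`, where `ξ_{a,t}` is the classical point `a` for `t ≤ 0`. -/
noncomputable def xi (a : ℂ_[p]) (t : ℝ) : BerkovichLine p :=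
  if h : 0 < t then diskPoint a t h else classical a

theorem xi_of_pos (a : ℂ_[p]) {t : ℝ} (h : 0 < t) : xi a t = diskPoint a t h := dif_pos h

theorem xi_eval_X_sub_C (a b : ℂ_[p]) (t : ℝ) : (xi a t).eval (X - C b) = max ‖a - b‖ t := by
  by_cases h : 0 < t
  · rw [xi_of_pos a h, diskPoint_eval_X_sub_C]
  · rw [xi, dif_neg h, classical_eval_X_sub_C, max_eq_left]
    exact (not_lt.mp h).trans (norm_nonneg _)

theorem continuous_xi (a : ℂ_[p]) : Continuous (xi a) :=
  continuous_of_linear fun b => by simp only [xi_eval_X_sub_C]; fun_prop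

theorem xi_eq_xi {a b : ℂ_[p]} {t : ℝ} (h : ‖a - b‖ ≤ t) : xi a t = xi b t :=
  ext_linear fun e => by
    rw [xi_eval_X_sub_C, xi_eval_X_sub_C]
    refine le_antisymm (max_le ?_ (le_max_right _ _)) (max_le ?_ (le_max_right _ _))
    · rw [max_comm, ← sub_add_sub_cancel a b e]
      exact (IsUltrametricDist.norm_add_le_max _ _).trans (max_le_max_right _ h)
    · rw [max_comm, ← sub_add_sub_cancel b a e]
      rw [norm_sub_rev] at h
      exact (IsUltrametricDist.norm_add_le_max _ _).trans (max_le_max_right _ h)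

/-! ### Connectedness of annuli -/

/-- For a finite set of centers containing a, let b be one nearest to x. The disk around b of radius
|x - b| then has the same distance as x to every center of the set. As the set grows, these disk
points converge to x, including when x is of type IV. -/
theorem mem_closure_xi (x : BerkovichLine p) (a : ℂ_[p]) :
    x ∈ closure {y | (∃ b t, 0 ≤ t ∧ y = xi b t) ∧ y.eval (X - C a) = x.eval (X - C a)} := by
  classical
  have hmin : ∀ s : Finset ℂ_[p], ∃ b ∈ insert a s, ∀ e ∈ insert a s,
      x.eval (X - C b) ≤ x.eval (X - C e) := fun s =>
    (insert a s).exists_min_image _ (Finset.insert_nonempty a s)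
  choose b hb hmin using hmin
  have hval : ∀ s : Finset ℂ_[p], ∀ e ∈ insert a s,
      (xi (b s) (x.eval (X - C (b s)))).eval (X - C e) = x.eval (X - C e) := fun s e he => by
    rw [xi_eval_X_sub_C]
    refine le_antisymm (max_le ((x.norm_sub_le_max _ _).trans (max_le ?_ le_rfl)) ?_) ?_
    · exact hmin s e he
    · exact hmin s e he
    · rw [max_comm]
      exact x.eval_X_sub_C_le _ _
  refine mem_closure_of_tendsto (b := atTop)
    (f := fun s => xi (b s) (x.eval (X - C (b s)))) ?_ (Eventually.of_forall fun s =>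
      ⟨⟨_, _, x.eval_nonneg _, rfl⟩, hval s a (Finset.mem_insert_self _ _)⟩)
  rw [nhds_induced, tendsto_comap_iff, tendsto_pi_nhds]
  intro g
  -- As soon as s contains the roots of g, the values at g agree exactly.
  refine tendsto_const_nhds.congr' ?_
  filter_upwards [eventually_ge_atTop g.roots.toFinset] with s hs
  change x.eval g = BerkovichLine.eval _ g
  rw [eval_eq_prod_roots x, eval_eq_prod_roots _ g]
  congr 2
  refine Multiset.map_congr rfl fun e he => (hval s e ?_).symm
  exact Finset.mem_insert_of_mem (hs (Multiset.mem_toFinset.mpr he))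

/-- By `mem_closure_xi` the points ξ_{b,t} of the annulus are dense in it, so it suffices to join
these. Growing the radius from t to m = max(|b - a|, t) leaves the distance to a unchanged and ends
at ξ_{a,m}; the points ξ_{a,m} are joined along the ray at a, on which the distance to a is the
radius. -/
theorem isPreconnected_annulus (a : ℂ_[p]) {J : Set ℝ} (hJ : J.OrdConnected) :
    IsPreconnected {x : BerkovichLine p | x.eval (X - C a) ∈ J} := by
  set S := {x : BerkovichLine p | x.eval (X - C a) ∈ J}
  set S' := {y : BerkovichLine p | (∃ b t, 0 ≤ t ∧ y = xi b t) ∧ y ∈ S}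
  refine IsPreconnected.subset_closure (s := S') ?_ (fun y hy => hy.2) fun x hx => by
    refine closure_mono ?_ (x.mem_closure_xi a)
    rintro y ⟨hy, hyx⟩
    refine ⟨hy, ?_⟩
    change y.eval _ ∈ J
    rw [hyx]
    exact hx
  have hray : ∀ (b : ℂ_[p]) (t u : ℝ), (∀ v ∈ Set.Icc t u, max ‖b - a‖ v ∈ J) → 0 ≤ t →
      xi b '' Set.Icc t u ⊆ S' := by
    rintro b t u h ht _ ⟨v, hv, rfl⟩
    refine ⟨⟨b, v, ht.trans hv.1, rfl⟩, ?_⟩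
    change BerkovichLine.eval _ _ ∈ J
    rw [xi_eval_X_sub_C]
    exact h v hv
  have hraypre : ∀ (b : ℂ_[p]) (t u : ℝ), IsPreconnected (xi b '' Set.Icc t u) := fun b t u =>
    isPreconnected_Icc.image _ (continuous_xi b).continuousOn
  refine isPreconnected_of_forall_pair ?_
  rintro _ ⟨⟨b, t, ht, rfl⟩, hb⟩ _ ⟨⟨b', t', ht', rfl⟩, hb'⟩
  change BerkovichLine.eval _ _ ∈ J at hb hb'
  rw [xi_eval_X_sub_C] at hb hb'
  set m := max ‖b - a‖ t
  set m' := max ‖b' - a‖ t'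
  have key : ∀ (b : ℂ_[p]) (t : ℝ), 0 ≤ t → max ‖b - a‖ t ∈ J →
      xi b '' Set.Icc t (max ‖b - a‖ t) ⊆ S' ∧
      xi b t ∈ xi b '' Set.Icc t (max ‖b - a‖ t) ∧
      xi a (max ‖b - a‖ t) ∈ xi b '' Set.Icc t (max ‖b - a‖ t) := by
    intro b t ht hb
    refine ⟨hray _ _ _ (fun v hv => ?_) ht, ⟨t, ⟨le_rfl, le_max_right _ _⟩, rfl⟩,
      ⟨_, ⟨le_max_right _ _, le_rfl⟩, xi_eq_xi (le_max_left _ _)⟩⟩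
    have : max ‖b - a‖ v = max ‖b - a‖ t :=
      le_antisymm (max_le (le_max_left _ _) hv.2) (max_le_max_left _ hv.1)
    rwa [this]
  obtain ⟨k1, k2, k3⟩ := key b t ht hb
  obtain ⟨k1', k2', k3'⟩ := key b' t' ht' hb'
  have hm0 : 0 ≤ m := le_max_of_le_right ht
  have hm0' : 0 ≤ m' := le_max_of_le_right ht'
  have hu : Set.Icc (min m m') (max m m') ⊆ J := by
    refine hJ.out ?_ ?_
    · rcases min_choice m m' with h | h <;> rw [h] <;> assumption
    · rcases max_choice m m' with h | h <;> rw [h] <;> assumption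
  refine ⟨(xi b '' Set.Icc t m ∪ xi a '' Set.Icc (min m m') (max m m')) ∪
    xi b' '' Set.Icc t' m', ?_, Or.inl (Or.inl k2), Or.inr k2', ?_⟩
  · refine Set.union_subset (Set.union_subset k1 (hray _ _ _ (fun v hv => ?_) (le_min hm0 hm0')))
      k1'
    rw [sub_self, norm_zero, max_eq_right ((le_min hm0 hm0').trans hv.1)]
    exact hu hv
  · refine IsPreconnected.union (xi a m') (Or.inr ⟨m', ⟨min_le_right _ _, le_max_right _ _⟩, rfl⟩)
      k3' ?_ (hraypre _ _ _)
    exact IsPreconnected.union (xi a m) k3 ⟨m, ⟨min_le_left _ _, le_max_left _ _⟩, rfl⟩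
      (hraypre _ _ _) (hraypre _ _ _)

end BerkovichLine

/-! ### The integer ring and the residue field of ℂ_p -/

section IntegerRing

variable {p : ℕ} [Fact p.Prime]

theorem mem_padicComplexInt_iff (z : ℂ_[p]) : z ∈ 𝓞_ℂ_[p] ↔ ‖z‖ ≤ 1 := by
  rw [PadicComplex.norm_eq_norm]
  exact (Valued.toNormedField.norm_le_one_iff (L := ℂ_[p])).symm

theorem residue_eq_residue_iff (w w' : 𝓞_ℂ_[p]) :
    IsLocalRing.residue 𝓞_ℂ_[p] w = IsLocalRing.residue 𝓞_ℂ_[p] w' ↔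
      ‖(w : ℂ_[p]) - w'‖ < 1 := by
  have hle : ‖((w - w' : 𝓞_ℂ_[p]) : ℂ_[p])‖ ≤ 1 := (mem_padicComplexInt_iff _).mp (w - w').2
  rw [← sub_eq_zero, ← map_sub, IsLocalRing.residue_eq_zero_iff, IsLocalRing.mem_maximalIdeal,
    mem_nonunits_iff, ← not_iff_not, not_not, not_lt]
  change IsUnit (w - w') ↔ 1 ≤ ‖((w - w' : 𝓞_ℂ_[p]) : ℂ_[p])‖
  generalize w - w' = u at hle
  constructor
  · intro h
    obtain ⟨v, hv⟩ := h.exists_right_inv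
    have hv1 : ‖(v : ℂ_[p])‖ ≤ 1 := (mem_padicComplexInt_iff _).mp v.2
    have h1 : ‖(u : ℂ_[p])‖ * ‖(v : ℂ_[p])‖ = 1 := by
      rw [← norm_mul]
      have := congrArg (fun y : 𝓞_ℂ_[p] => ‖(y : ℂ_[p])‖) hv
      simpa using this
    nlinarith [norm_nonneg (u : ℂ_[p]), norm_nonneg (v : ℂ_[p])]
  · intro h
    have hu : ‖(u : ℂ_[p])‖ = 1 := le_antisymm hle h
    have hu0 : (u : ℂ_[p]) ≠ 0 := by
      intro h0
      rw [h0, norm_zero] at hu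
      exact zero_ne_one hu
    refine IsUnit.of_mul_eq_one ⟨(u : ℂ_[p])⁻¹, (mem_padicComplexInt_iff _).mpr ?_⟩ ?_
    · rw [norm_inv, hu, inv_one]
    · exact Subtype.ext (mul_inv_cancel₀ hu0)

end IntegerRing

/-! ### Directions at type II points and tangent maps -/

namespace BerkovichLine

variable {p : ℕ} [Fact p.Prime]

theorem isOpen_openDisk (a : ℂ_[p]) (r : ℝ) : IsOpen (openDisk a r) :=
  isOpen_Iio.preimage (continuous_eval (X - C a))

theorem mem_openDisk {x : BerkovichLine p} {a : ℂ_[p]} {r : ℝ} :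
    x ∈ openDisk a r ↔ x.eval (X - C a) < r := Iff.rfl

/-- A partition of the complement of `x` into connected open sets is the partition into
directions. -/
theorem bijOn_directions {ι : Type*} {θ : ι → Set (BerkovichLine p)} {x : BerkovichLine p}
    (hopen : ∀ i, IsOpen (θ i)) (hpre : ∀ i, IsPreconnected (θ i)) (hne : ∀ i, (θ i).Nonempty)
    (hdisj : ∀ i j, i ≠ j → Disjoint (θ i) (θ j)) (hcover : ⋃ i, θ i = {x}ᶜ) :
    Set.BijOn θ Set.univ (directions x) := by
  have hsub : ∀ i, θ i ⊆ {x}ᶜ := fun i => hcover ▸ Set.subset_iUnion θ i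
  have hcomp : ∀ i, ∀ y ∈ θ i, connectedComponentIn {x}ᶜ y = θ i := fun i y hy => by
    refine Set.Subset.antisymm ?_ ((hpre i).subset_connectedComponentIn hy (hsub i))
    -- The component of y is covered by two disjoint open sets, `θ i` and the union of the other
    -- pieces, and it meets the first.
    refine isPreconnected_connectedComponentIn.subset_left_of_subset_union (hopen i)
      (v := ⋃ j ∈ {j | j ≠ i}, θ j) (isOpen_biUnion fun j _ => hopen j) ?_ ?_
      ⟨y, mem_connectedComponentIn (hsub i hy), hy⟩
    · exact Set.disjoint_iUnion₂_right.mpr fun j hj => hdisj i j (Ne.symm hj)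
    · refine (connectedComponentIn_subset _ _).trans ?_
      rw [← hcover]
      refine Set.iUnion_subset fun j => ?_
      by_cases hj : j = i
      · exact hj ▸ Set.subset_union_left
      · exact (Set.subset_biUnion_of_mem (u := θ) (show j ∈ {j | j ≠ i} from hj)).trans
          Set.subset_union_right
  refine ⟨fun i _ => ?_, fun i _ j _ hij => ?_, ?_⟩
  · obtain ⟨y, hy⟩ := hne i
    exact ⟨y, hsub i hy, (hcomp i y hy).symm⟩
  · by_contra hne'
    obtain ⟨y, hy⟩ := hne i
    exact Set.disjoint_left.mp (hdisj i j hne') hy (hij ▸ hy)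
  · rintro _ ⟨y, hy, rfl⟩
    rw [← hcover] at hy
    obtain ⟨i, hi⟩ := Set.mem_iUnion.mp hy
    exact ⟨i, Set.mem_univ i, (hcomp i y hi).symm⟩

/-- The directions at `ξ_{a,|b|}` in the coordinate `z = a + b w`. -/
noncomputable def tangentDisk (a b : ℂ_[p]) :
    OnePoint (IsLocalRing.ResidueField 𝓞_ℂ_[p]) → Set (BerkovichLine p)
  | none => {x | ‖b‖ < x.eval (X - C a)}
  | some t => openDisk
      (a + b * (Function.surjInv (IsLocalRing.residue_surjective (R := 𝓞_ℂ_[p])) t : 𝓞_ℂ_[p])) ‖b‖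

theorem mem_tangentDisk_infty {a b : ℂ_[p]} {x : BerkovichLine p} :
    x ∈ tangentDisk a b OnePoint.infty ↔ ‖b‖ < x.eval (X - C a) := Iff.rfl

theorem openDisk_congr {a a' : ℂ_[p]} {r : ℝ} (h : ‖a - a'‖ < r) :
    openDisk a r = openDisk a' r := by
  ext x
  rw [mem_openDisk, mem_openDisk]
  constructor <;> intro hx
  · exact (x.eval_X_sub_C_le a a').trans_lt (max_lt hx h)
  · rw [norm_sub_rev] at h
    exact (x.eval_X_sub_C_le a' a).trans_lt (max_lt hx h)

theorem norm_affine_sub (a b w w' : ℂ_[p]) : ‖(a + b * w) - (a + b * w')‖ = ‖b‖ * ‖w - w'‖ := by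
  rw [← norm_mul]
  ring_nf

/-- Frees `tangentDisk` from its chosen representative: two lifts of a residue class differ by less
than 1, and any point of an open ultrametric disk is a center. -/
theorem tangentDisk_residue (a : ℂ_[p]) {b : ℂ_[p]} (hb : b ≠ 0) (w : 𝓞_ℂ_[p]) :
    tangentDisk a b (IsLocalRing.residue 𝓞_ℂ_[p] w : IsLocalRing.ResidueField 𝓞_ℂ_[p]) =
      openDisk (a + b * (w : ℂ_[p])) ‖b‖ := by
  refine openDisk_congr ?_
  rw [norm_affine_sub]
  refine mul_lt_of_lt_one_right (norm_pos_iff.mpr hb) ((residue_eq_residue_iff _ _).mp ?_)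
  exact Function.surjInv_eq _ _

theorem exists_affine {a b z : ℂ_[p]} (hb : b ≠ 0) (h : ‖z - a‖ ≤ ‖b‖) :
    ∃ w : 𝓞_ℂ_[p], z = a + b * (w : ℂ_[p]) := by
  refine ⟨⟨(z - a) / b, (mem_padicComplexInt_iff _).mpr ?_⟩, ?_⟩
  · rw [norm_div]
    exact div_le_one_of_le₀ h (norm_nonneg _)
  · change z = a + b * ((z - a) / b)
    field_simp
    ring

/-- The pieces are open, preconnected and disjoint, so `bijOn_directions` applies once they cover
the complement. A point y in none of them has |y - a| ≤ |b| and |y - e| ≥ |b| for all e in the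
closed disk. The ultrametric inequality then gives it the distances of ξ_{a,|b|} to all centers. -/
theorem bijOn_tangentDisk (a : ℂ_[p]) {b : ℂ_[p]} (hb : b ≠ 0) :
    Set.BijOn (tangentDisk a b) Set.univ
      (directions (diskPoint a ‖b‖ (norm_pos_iff.mpr hb))) := by
  have hb0 : 0 < ‖b‖ := norm_pos_iff.mpr hb
  have hsurj : ∀ t : IsLocalRing.ResidueField 𝓞_ℂ_[p], ∃ w, IsLocalRing.residue 𝓞_ℂ_[p] w = t :=
    IsLocalRing.residue_surjective
  have hw : ∀ w : 𝓞_ℂ_[p], ‖(w : ℂ_[p])‖ ≤ 1 := fun w => (mem_padicComplexInt_iff _).mp w.2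
  have hdisj : ∀ (w : 𝓞_ℂ_[p]) (x : BerkovichLine p), x ∈ openDisk (a + b * (w : ℂ_[p])) ‖b‖ →
      x.eval (X - C a) ≤ ‖b‖ := fun w x hx => by
    refine (x.eval_X_sub_C_le (a + b * (w : ℂ_[p])) a).trans (max_le (mem_openDisk.mp hx).le ?_)
    rw [add_sub_cancel_left, norm_mul]
    exact mul_le_of_le_one_right hb0.le (hw w)
  refine bijOn_directions ?_ ?_ ?_ ?_ ?_
  · rintro (_ | t)
    · exact isOpen_Ioi.preimage (continuous_eval (X - C a))
    · exact isOpen_openDisk _ _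
  · rintro (_ | t)
    · exact isPreconnected_annulus a (J := Set.Ioi ‖b‖) Set.ordConnected_Ioi
    · exact isPreconnected_annulus _ (J := Set.Iio ‖b‖) Set.ordConnected_Iio
  · rintro (_ | t)
    · refine ⟨xi a (‖b‖ + 1), ?_⟩
      change ‖b‖ < BerkovichLine.eval _ _
      rw [xi_eval_X_sub_C]
      exact lt_max_of_lt_right (lt_add_one _)
    · refine ⟨classical (a + b * (Function.surjInv (IsLocalRing.residue_surjective
        (R := 𝓞_ℂ_[p])) t : 𝓞_ℂ_[p])), ?_⟩
      change BerkovichLine.eval _ _ < _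
      rw [classical_eval_X_sub_C, sub_self, norm_zero]
      exact hb0
  · rintro (_ | t) (_ | t') hne
    · exact absurd rfl hne
    · exact Set.disjoint_left.mpr fun x hx hx' => (hdisj _ x hx').not_gt hx
    · exact Set.disjoint_left.mpr fun x hx hx' => (hdisj _ x hx).not_gt hx'
    · obtain ⟨w, rfl⟩ := hsurj t
      obtain ⟨w', rfl⟩ := hsurj t'
      refine Set.disjoint_left.mpr fun x hx hx' => hne ?_
      change x ∈ tangentDisk a b (IsLocalRing.residue 𝓞_ℂ_[p] w :
        IsLocalRing.ResidueField 𝓞_ℂ_[p]) at hx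
      change x ∈ tangentDisk a b (IsLocalRing.residue 𝓞_ℂ_[p] w' :
        IsLocalRing.ResidueField 𝓞_ℂ_[p]) at hx'
      rw [tangentDisk_residue a hb, mem_openDisk] at hx hx'
      refine congrArg some ((residue_eq_residue_iff w w').mpr ?_)
      have h1 := (x.norm_sub_le_max _ _).trans_lt (max_lt hx hx')
      rw [norm_affine_sub] at h1
      exact (mul_lt_iff_lt_one_right hb0).mp h1
  · ext y
    rw [Set.mem_iUnion, Set.mem_compl_singleton_iff]
    constructor
    · rintro ⟨_ | t, hy⟩ rfl
      · change ‖b‖ < BerkovichLine.eval _ _ at hy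
        rw [diskPoint_eval_X_sub_C, sub_self, norm_zero, max_eq_right hb0.le] at hy
        exact lt_irrefl _ hy
      · change BerkovichLine.eval _ _ < ‖b‖ at hy
        rw [diskPoint_eval_X_sub_C] at hy
        exact (le_max_right _ _).not_gt hy
    · intro hy
      by_contra! hno
      have h1 : y.eval (X - C a) ≤ ‖b‖ := not_lt.mp (hno OnePoint.infty)
      refine hy (ext_linear fun e => ?_)
      rw [diskPoint_eval_X_sub_C]
      refine le_antisymm ((y.eval_X_sub_C_le a e).trans ?_) (max_le ?_ ?_)
      · rw [max_comm]
        exact max_le_max_left _ h1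
      · by_contra! hlt
        have h2 : ¬ ‖e - a‖ ≤ ‖b‖ := fun h => by
          obtain ⟨w, rfl⟩ := exists_affine hb h
          have h3 := hno (IsLocalRing.residue 𝓞_ℂ_[p] w : IsLocalRing.ResidueField 𝓞_ℂ_[p])
          rw [tangentDisk_residue a hb, mem_openDisk, not_lt] at h3
          rw [norm_sub_rev] at h
          exact (h3.trans_lt hlt).not_ge h
        rw [norm_sub_rev] at h2
        exact (y.norm_sub_le_max a e).not_gt (max_lt (h1.trans_lt (not_le.mp h2)) hlt)
      · by_cases h : ‖e - a‖ ≤ ‖b‖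
        · obtain ⟨w, rfl⟩ := exists_affine hb h
          have h3 := hno (IsLocalRing.residue 𝓞_ℂ_[p] w : IsLocalRing.ResidueField 𝓞_ℂ_[p])
          rwa [tangentDisk_residue a hb, mem_openDisk, not_lt] at h3
        · by_contra! hlt
          have := y.norm_sub_le_max e a
          exact h (this.trans (max_le hlt.le h1))

theorem isTangentCoordinate_tangentDisk (a : ℂ_[p]) {b : ℂ_[p]} (hb : b ≠ 0) :
    IsTangentCoordinate (diskPoint a ‖b‖ (norm_pos_iff.mpr hb)) (tangentDisk a b) := by
  refine ⟨bijOn_tangentDisk a hb, a, b, hb, rfl, fun w => ?_, fun z hz => ?_⟩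
  · rw [tangentDisk_residue a hb, mem_openDisk, classical_eval_X_sub_C, sub_self, norm_zero]
    exact norm_pos_iff.mpr hb
  · rwa [mem_tangentDisk_infty, classical_eval_X_sub_C]

/-- Each direction is approached along a ray ξ_{e,u} with u tending to |b|, from above for ∞ and
from below otherwise. This is the hypothesis that makes tangent images unique. -/
theorem mem_closure_tangentDisk (a : ℂ_[p]) {b : ℂ_[p]} (hb : b ≠ 0)
    (t : OnePoint (IsLocalRing.ResidueField 𝓞_ℂ_[p])) :
    diskPoint a ‖b‖ (norm_pos_iff.mpr hb) ∈ closure (tangentDisk a b t) := by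
  have hb0 : 0 < ‖b‖ := norm_pos_iff.mpr hb
  rw [← xi_of_pos a hb0]
  rcases t with _ | t
  · refine mem_closure_of_tendsto (((continuous_xi a).tendsto ‖b‖).mono_left
      (nhdsWithin_le_nhds (s := Set.Ioi ‖b‖))) ?_
    filter_upwards [self_mem_nhdsWithin] with u hu
    change ‖b‖ < BerkovichLine.eval _ _
    rw [xi_eval_X_sub_C]
    exact lt_max_of_lt_right hu
  · obtain ⟨w, rfl⟩ := IsLocalRing.residue_surjective t
    have h1 : xi a ‖b‖ = xi (a + b * (w : ℂ_[p])) ‖b‖ := by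
      refine xi_eq_xi ?_
      rw [sub_add_cancel_left, norm_neg, norm_mul]
      exact mul_le_of_le_one_right hb0.le ((mem_padicComplexInt_iff _).mp w.2)
    rw [h1]
    refine mem_closure_of_tendsto (((continuous_xi (a + b * (w : ℂ_[p]))).tendsto ‖b‖).mono_left
      (nhdsWithin_le_nhds (s := Set.Iio ‖b‖))) ?_
    filter_upwards [self_mem_nhdsWithin] with u hu
    change _ ∈ tangentDisk a b (IsLocalRing.residue 𝓞_ℂ_[p] w :
        IsLocalRing.ResidueField 𝓞_ℂ_[p])
    rw [tangentDisk_residue a hb, mem_openDisk, xi_eval_X_sub_C, sub_self, norm_zero]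
    exact max_lt hb0 hu

/-- The tangent image of a direction in whose closure `x` lies is unique. -/
theorem isTangentImage_iff_of_mapsTo {F : BerkovichLine p → BerkovichLine p}
    {x : BerkovichLine p} {D E : Set (BerkovichLine p)} (hD : D ∈ directions x)
    (hE : E ∈ directions (F x)) (hcl : x ∈ closure D) {U : Set (BerkovichLine p)} (hU : U ∈ 𝓝 x)
    (hmap : ∀ y ∈ D ∩ U, F y ∈ E) (E' : Set (BerkovichLine p)) :
    IsTangentImage F x D E' ↔ E' = E := by
  constructor
  · rintro ⟨-, ⟨e', -, rfl⟩, U', hU', hmap'⟩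
    obtain ⟨e, -, rfl⟩ := hE
    -- Some y in D lies in both neighborhoods, so E and E' are components with the common point F y.
    obtain ⟨y, hyU, hyD⟩ := mem_closure_iff_nhds.mp hcl _ (inter_mem hU hU')
    have h1 := connectedComponentIn_eq (hmap y ⟨hyD, hyU.1⟩)
    have h2 := connectedComponentIn_eq (hmap' ⟨y, ⟨hyD, hyU.2⟩, rfl⟩)
    rw [h1, h2]
  · rintro rfl
    exact ⟨hD, hE, U, hU, Set.image_subset_iff.mpr hmap⟩

end BerkovichLine

/-! ### The map f_c as the limit of its partial products -/

section Approximation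

variable {p : ℕ} [Fact p.Prime]

theorem norm_natCast_prime : ‖(p : ℂ_[p])‖ = (p : ℝ)⁻¹ := by
  have h := PadicComplex.norm_extends' p (p : ℚ_[p])
  rw [Padic.norm_p] at h
  rw [← h]
  congr 1
  simp

theorem norm_inv_natCast_prime : ‖(p : ℂ_[p])⁻¹‖ = p := by
  rw [norm_inv, norm_natCast_prime, inv_inv]

/-- Consecutive partial products differ by at most K r / |c_N|, which tends to 0; the ultrametric
inequality turns the telescoping sum into a maximum. -/
theorem exists_norm_coeff_partialPoly_sub_le {c : ℕ → ℂ_[p]}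
    (hc : Tendsto (fun j => ‖c j‖) atTop atTop) {r : ℝ} (hr : 0 < r) {ε : ℝ} (hε : 0 < ε) :
    ∃ N₀, ∀ N ≥ N₀, ∀ M ≥ N, ∀ i,
      ‖(partialPoly c M).coeff i - (partialPoly c N).coeff i‖ * r ^ i ≤ ε := by
  obtain ⟨K, -, -, hK⟩ := exists_gaussNorm_partialPoly_le hc hr
  have h1 : Tendsto (fun j => K * (r / ‖c j‖)) atTop (𝓝 0) := by
    simpa using (hc.const_div_atTop r).const_mul K
  obtain ⟨N₀, hN₀⟩ := eventually_atTop.mp (h1.eventually (ge_mem_nhds hε))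
  refine ⟨N₀, fun N hN M hM i => ?_⟩
  induction M, hM using Nat.le_induction with
  | base => simpa using hε.le
  | succ M hM ih =>
    rw [← sub_add_sub_cancel _ ((partialPoly c M).coeff i)]
    refine (mul_le_mul_of_nonneg_right (IsUltrametricDist.norm_add_le_max _ _)
      (by positivity)).trans ?_
    rw [max_mul_of_nonneg _ _ (by positivity)]
    exact max_le ((hK M i).trans (hN₀ M (hN.le.trans hM))) ih

theorem tendsto_eval_partialPoly {c : ℕ → ℂ_[p]} (hc : Tendsto (fun j => ‖c j‖) atTop atTop)
    (z : ℂ_[p]) : Tendsto (fun N => (partialPoly c N).eval z) atTop (𝓝 (fc c z)) := by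
  have h1 := ((multipliable_one_sub_div hc z).hasProd.tendsto_prod_nat).const_mul
    (z ^ p / (p : ℂ_[p]))
  refine h1.congr fun N => ?_
  rw [partialPoly, Polynomial.eval_mul, Polynomial.eval_prod]
  simp [div_eq_inv_mul]

/-- The limits of the coefficients form an entire power series, and the bound uniform in i
identifies its sum with the infinite product. Uniqueness of the expansion makes these limits the
Taylor coefficients. -/
theorem tendsto_coeff_partialPoly {c : ℕ → ℂ_[p]} (hc : Tendsto (fun j => ‖c j‖) atTop atTop)
    (i : ℕ) : Tendsto (fun N => (partialPoly c N).coeff i) atTop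
      (𝓝 (taylorCoeff (fc c) 0 i)) := by
  have hq : ∀ i, ∃ q, Tendsto (fun N => (partialPoly c N).coeff i) atTop (𝓝 q) := fun i => by
    refine cauchySeq_tendsto_of_complete (Metric.cauchySeq_iff'.mpr fun ε hε => ?_)
    obtain ⟨N₀, h₀⟩ := exists_norm_coeff_partialPoly_sub_le hc one_pos (half_pos hε)
    refine ⟨N₀, fun N hN => ?_⟩
    have := h₀ N₀ le_rfl N hN i
    rw [one_pow, mul_one] at this
    rw [dist_eq_norm]
    linarith
  choose q hq using hq
  set P := FormalMultilinearSeries.ofScalars ℂ_[p] q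
  have hcoeff : ∀ i, P.coeff i = q i := fun i => FormalMultilinearSeries.coeff_ofScalars
  have hrad : P.radius = ⊤ := by
    refine ENNReal.eq_top_of_forall_nnreal_le fun r => ?_
    obtain ⟨K, -, hK, -⟩ := exists_gaussNorm_partialPoly_le hc (r := (r : ℝ) + 1) (by positivity)
    refine le_trans ?_ (P.le_radius_of_bound (r := r + 1) K fun i => ?_)
    · exact_mod_cast le_self_add
    · rw [P.norm_apply_eq_norm_coef, hcoeff]
      exact le_of_tendsto' ((hq i).norm.mul_const _) fun N => hK N i
  have hball : HasFPowerSeriesOnBall P.sum P 0 ⊤ := by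
    have := P.hasFPowerSeriesOnBall (by rw [hrad]; exact ENNReal.zero_lt_top)
    rwa [hrad] at this
  suffices h : P.sum = fc c by
    rw [← h, hball.taylorCoeff_eq, hcoeff]
    exact hq i
  funext z
  have hsum : HasSum (fun i => q i * z ^ i) (P.sum z) := by
    have := hball.hasSum (y := z) (by simp)
    rw [zero_add] at this
    refine this.congr_fun fun i => ?_
    rw [FormalMultilinearSeries.apply_eq_pow_smul_coeff, hcoeff, smul_eq_mul, mul_comm]
  refine tendsto_nhds_unique (Metric.tendsto_atTop.mpr fun ε hε => ?_)
    (tendsto_eval_partialPoly hc z)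
  obtain ⟨N₀, h₀⟩ := exists_norm_coeff_partialPoly_sub_le hc (r := ‖z‖ + 1) (by positivity)
    (half_pos hε)
  refine ⟨N₀, fun N hN => ?_⟩
  have h1 : HasSum (fun i => (partialPoly c N).coeff i * z ^ i) ((partialPoly c N).eval z) := by
    rw [Polynomial.eval_eq_sum_range]
    refine hasSum_sum_of_ne_finset_zero fun i hi => ?_
    rw [coeff_eq_zero_of_natDegree_lt (by simpa using hi), zero_mul]
  have h2 : ∀ i, ‖q i * z ^ i - (partialPoly c N).coeff i * z ^ i‖ ≤ ε / 2 := fun i => by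
    rw [← sub_mul, norm_mul, norm_pow]
    refine (mul_le_mul_of_nonneg_left (pow_le_pow_left₀ (norm_nonneg z)
      (le_add_of_nonneg_right zero_le_one) i) (norm_nonneg _)).trans ?_
    exact le_of_tendsto (((hq i).sub_const _).norm.mul_const _)
      (eventually_atTop.mpr ⟨N, fun M hM => h₀ N hN M hM i⟩)
  have h3 : ‖P.sum z - (partialPoly c N).eval z‖ ≤ ε / 2 := by
    refine le_of_tendsto' (hsum.sub h1).tendsto_sum_nat.norm fun m => ?_
    exact IsUltrametricDist.norm_sum_le_of_forall_le_of_nonneg (half_pos hε).le fun i _ => h2 i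
  rw [dist_comm, dist_eq_norm]
  linarith

namespace BerkovichLine

/-- Passes from the Taylor polynomials, through which the action is defined, to the partial
products, whose values are explicit. -/
theorem eval_taylorPoly_sub_partialPoly_le {c : ℕ → ℂ_[p]}
    (hc : Tendsto (fun j => ‖c j‖) atTop atTop) (x : BerkovichLine p) {ε : ℝ} (hε : 0 < ε) :
    ∃ N₀, ∀ N ≥ N₀, ∀ᶠ M in atTop,
      x.eval (taylorPoly (fc c) M - partialPoly c N) ≤ ε := by
  -- The shift by 1 keeps the radius positive when |x| = 0.
  obtain ⟨N₀, h₀⟩ := exists_norm_coeff_partialPoly_sub_le hc (r := x.eval X + 1)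
    (by have := x.eval_nonneg X; positivity) hε
  refine ⟨N₀, fun N hN => ?_⟩
  filter_upwards [eventually_gt_atTop (partialPoly c N).natDegree] with M hM
  rw [(partialPoly c N).as_sum_range' M hM, taylorPoly, ← Finset.sum_sub_distrib]
  refine x.eval_sum_le_of_le _ _ hε.le fun i _ => ?_
  rw [← C_mul_X_pow_eq_monomial, ← sub_mul, ← C_sub, eval_mul, eval_C, eval_pow]
  refine (mul_le_mul_of_nonneg_left (pow_le_pow_left₀ (x.eval_nonneg X)
    (le_add_of_nonneg_right zero_le_one) i) (norm_nonneg _)).trans ?_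
  exact le_of_tendsto (((tendsto_coeff_partialPoly hc i).sub_const _).norm.mul_const _)
    (eventually_atTop.mpr ⟨N, fun M hM => h₀ N hN M hM i⟩)

/-- The action of `f_c` on the Berkovich line through the partial products. -/
theorem tendsto_eval_partialPoly_sub {c : ℕ → ℂ_[p]}
    (hc : Tendsto (fun j => ‖c j‖) atTop atTop) (hf : IsEntire (fc c)) (x : BerkovichLine p)
    {a : ℕ → ℂ_[p]} {a₀ : ℂ_[p]} (ha : Tendsto a atTop (𝓝 a₀)) :
    Tendsto (fun N => x.eval (partialPoly c N - C (a N))) atTop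
      (𝓝 ((map hf x).eval (X - C a₀))) := by
  have h1 : Tendsto (fun M => x.eval (taylorPoly (fc c) M - C a₀)) atTop
      (𝓝 ((map hf x).eval (X - C a₀))) := by
    refine (tendsto_evalComp hf x (X - C a₀)).congr fun M => ?_
    rw [sub_comp, X_comp, C_comp]
  refine Metric.tendsto_atTop.mpr fun ε hε => ?_
  obtain ⟨N₀, h₀⟩ := x.eval_taylorPoly_sub_partialPoly_le hc (half_pos hε)
  obtain ⟨N₁, h₁⟩ := Metric.tendsto_atTop.mp ha (ε / 2) (half_pos hε)
  refine ⟨max N₀ N₁, fun N hN => ?_⟩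
  refine (?_ : _ ≤ ε / 2).trans_lt (half_lt_self hε)
  rw [dist_comm]
  refine le_of_tendsto (h1.dist tendsto_const_nhds) ?_
  filter_upwards [h₀ N (le_of_max_le_left hN)] with M hM
  rw [Real.dist_eq]
  refine (x.abs_eval_sub_eval_le _ _).trans ?_
  rw [sub_sub_sub_comm]
  refine (x.eval_sub_le_max _ _).trans (max_le hM ?_)
  rw [eval_C_sub_C, ← dist_eq_norm, dist_comm]
  exact (h₁ N (le_of_max_le_right hN)).le

theorem tendsto_eval_partialPoly_zero {c : ℕ → ℂ_[p]}
    (hc : Tendsto (fun j => ‖c j‖) atTop atTop) (hf : IsEntire (fc c)) (x : BerkovichLine p) :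
    Tendsto (fun N => x.eval (partialPoly c N)) atTop (𝓝 ((map hf x).eval X)) := by
  simpa using tendsto_eval_partialPoly_sub hc hf x (tendsto_const_nhds (x := (0 : ℂ_[p])))

theorem eval_factor (x : BerkovichLine p) {e : ℂ_[p]} (he : e ≠ 0) :
    x.eval (1 - C e⁻¹ * X) = x.eval (X - C e) / ‖e‖ := by
  have h : (1 - C e⁻¹ * X : ℂ_[p][X]) = C e⁻¹ * (C e - X) := by
    rw [mul_sub, ← C_mul, inv_mul_cancel₀ he, C_1]
  rw [h, eval_mul, eval_C, eval_sub_comm, norm_inv, inv_mul_eq_div]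

theorem eval_partialPoly {c : ℕ → ℂ_[p]} (h0 : ∀ j, c j ≠ 0) (x : BerkovichLine p) (N : ℕ) :
    x.eval (partialPoly c N) =
      p * x.eval X ^ p * ∏ j ∈ Finset.range N, (x.eval (X - C (c j)) / ‖c j‖) := by
  rw [partialPoly, eval_mul, eval_mul, eval_C, eval_pow, eval_prod, norm_inv_natCast_prime]
  simp only [eval_factor x (h0 _)]

theorem map_classical_eval {f : ℂ_[p] → ℂ_[p]} (hf : IsEntire f) (z a : ℂ_[p]) :
    (map hf (classical z)).eval (X - C a) = ‖f z - a‖ := by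
  rw [map_classical, classical_eval_X_sub_C]

theorem eval_X_sub_C_of_lt (x : BerkovichLine p) {a : ℂ_[p]} (h : x.eval X < ‖a‖) :
    x.eval (X - C a) = ‖a‖ := by
  rw [eval_sub_eq_right x (by rwa [eval_C]), eval_C]

theorem eval_X_of_lt (x : BerkovichLine p) {a : ℂ_[p]} (h : x.eval (X - C a) < ‖a‖) :
    x.eval X = ‖a‖ := by
  rcases le_total (x.eval X) ‖a‖ with h1 | h1
  · exact h1.antisymm ((le_max_iff.mp (x.norm_le_max a)).resolve_left (not_le.mpr h))
  · refine le_antisymm ?_ h1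
    have h2 := x.eval_X_sub_C_le a 0
    rw [C_0, sub_zero, sub_zero] at h2
    exact (le_max_iff.mp h2).resolve_left (not_le.mpr (h.trans_le h1))

/-- A point contained in arbitrarily small disks is classical. -/
theorem isTypeI_of_forall_exists (x : BerkovichLine p)
    (h : ∀ n : ℕ, ∃ a, x.eval (X - C a) ≤ 1 / ((n : ℝ) + 1)) : x.IsTypeI := by
  choose a ha using h
  have hlim := tendsto_one_div_add_atTop_nhds_zero_nat (𝕜 := ℝ)
  have hcau : CauchySeq a := by
    refine Metric.cauchySeq_iff'.mpr fun ε hε => ?_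
    obtain ⟨N, hN⟩ := (hlim.eventually (gt_mem_nhds hε)).exists
    refine ⟨N, fun n hn => ?_⟩
    rw [dist_eq_norm]
    refine (x.norm_sub_le_max _ _).trans_lt (max_lt ?_ ((ha N).trans_lt hN))
    exact ((ha n).trans (one_div_le_one_div_of_le (by positivity) (by gcongr))).trans_lt hN
  obtain ⟨b, hb⟩ := cauchySeq_tendsto_of_complete hcau
  refine ⟨b, eq_classical (le_antisymm ?_ (x.eval_nonneg _))⟩
  have h2 : Tendsto (fun n : ℕ => max (1 / ((n : ℝ) + 1)) ‖a n - b‖) atTop (𝓝 (max 0 0)) :=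
    hlim.max (tendsto_iff_norm_sub_tendsto_zero.mp hb)
  rw [max_self] at h2
  exact ge_of_tendsto' h2 fun n =>
    (x.eval_X_sub_C_le (a n) b).trans (max_le_max_right _ (ha n))

end BerkovichLine

end Approximation

/-! ### The critical radius ϱ -/

section Radius

/-- Characterizes ϱ as the positive fixed point of r ↦ p r^p, which decreases positive r < ϱ and
increases r > ϱ. -/
theorem natCast_mul_rho_pow (p : ℕ) [hp : Fact p.Prime] : (p : ℝ) * rho p ^ (p - 1) = 1 := by
  have hp0 : (0 : ℝ) < p := by exact_mod_cast hp.out.pos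
  have hp1 : (p : ℝ) - 1 ≠ 0 := sub_ne_zero.mpr (by exact_mod_cast hp.out.one_lt.ne')
  rw [rho, ← Real.rpow_natCast, ← Real.rpow_mul hp0.le, Nat.cast_sub hp.out.one_le, Nat.cast_one,
    div_mul_cancel₀ _ hp1, Real.rpow_neg_one, mul_inv_cancel₀ hp0.ne']

theorem natCast_mul_pow_eq (p : ℕ) [hp : Fact p.Prime] (r : ℝ) :
    (p : ℝ) * r ^ p = r * (p * r ^ (p - 1)) := by
  have h : r ^ p = r * r ^ (p - 1) := by rw [← pow_succ', Nat.sub_add_cancel hp.out.one_le]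
  rw [h]
  ring

theorem rho_lt_one (p : ℕ) [hp : Fact p.Prime] : rho p < 1 := by
  by_contra! h
  have h1 := natCast_mul_rho_pow p
  have h2 : (1 : ℝ) ≤ rho p ^ (p - 1) := one_le_pow₀ h
  have h3 : (1 : ℝ) < p := by exact_mod_cast hp.out.one_lt
  nlinarith

variable {p : ℕ} [hp : Fact p.Prime]

theorem natCast_mul_pow_lt_one {r : ℝ} (h0 : 0 ≤ r) (hr : r < rho p) :
    (p : ℝ) * r ^ (p - 1) < 1 := by
  rw [← natCast_mul_rho_pow p]
  have hp0 : (0 : ℝ) < p := by exact_mod_cast hp.out.pos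
  have := hp.out.one_lt
  gcongr
  omega

theorem one_lt_natCast_mul_pow {r : ℝ} (hr : rho p < r) : 1 < (p : ℝ) * r ^ (p - 1) := by
  rw [← natCast_mul_rho_pow p]
  have hp0 : (0 : ℝ) < p := by exact_mod_cast hp.out.pos
  have := hp.out.one_lt
  have := rho_pos p
  gcongr
  omega

theorem eq_rho_of_natCast_mul_pow_eq {r : ℝ} (h0 : 0 < r) (h : (p : ℝ) * r ^ p = r) :
    r = rho p := by
  rw [natCast_mul_pow_eq, mul_eq_left₀ h0.ne'] at h
  rcases lt_trichotomy r (rho p) with h1 | h1 | h1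
  · exact absurd h (natCast_mul_pow_lt_one h0.le h1).ne
  · exact h1
  · exact absurd h (one_lt_natCast_mul_pow h1).ne'

/-- The scale of the Frobenius coordinate: (b w)^p / p = b w^p exactly when b^(p-1) = p, for b ≠ 0.
-/
theorem exists_norm_eq_rho (p : ℕ) [hp : Fact p.Prime] :
    ∃ b : ℂ_[p], ‖b‖ = rho p ∧ b ^ (p - 1) = p := by
  have hp1 : p - 1 ≠ 0 := by have := hp.out.one_lt; omega
  obtain ⟨b, hb⟩ := IsAlgClosed.exists_pow_nat_eq (p : ℂ_[p]) (Nat.pos_of_ne_zero hp1)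
  refine ⟨b, ?_, hb⟩
  refine (pow_left_inj₀ (norm_nonneg b) (rho_pos p).le hp1).mp ?_
  rw [← norm_pow, hb, norm_natCast_prime]
  exact (eq_inv_of_mul_eq_one_right (natCast_mul_rho_pow p)).symm

end Radius

/-! ### Fixed points and the tangent map in the open unit disk -/

section UnitDisk

variable {p : ℕ} [hp : Fact p.Prime]

namespace BerkovichLine

/-- Expand (Y + a)^p with Y = X - a. The middle binomial coefficients are divisible by p, which
cancels the factor p = |1/p|; only Y^p keeps that factor. -/
theorem eval_pow_sub_le (x : BerkovichLine p) (a : ℂ_[p]) {r : ℝ} (ha : ‖a‖ ≤ r)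
    (hx : x.eval (X - C a) ≤ r) :
    p * x.eval (X ^ p - C (a ^ p)) ≤
      x.eval (X - C a) * max (p * x.eval (X - C a) ^ (p - 1)) (r ^ (p - 1)) := by
  have hp0 : (0 : ℝ) < p := by exact_mod_cast hp.out.pos
  set Y : ℂ_[p][X] := X - C a
  have hs := x.eval_nonneg Y
  have hr0 : 0 ≤ r := hs.trans hx
  have h1 : (X ^ p - C (a ^ p) : ℂ_[p][X]) = Y ^ p + C (p : ℂ_[p]) * (Y * C a *
      ∑ k ∈ Finset.Ioo 0 p, Y ^ (k - 1) * C a ^ (p - k - 1) * ↑(p.choose k / p)) := by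
    have h2 := add_pow_prime_eq hp.out Y (C a)
    rw [sub_add_cancel] at h2
    rw [C_pow, h2, C_eq_natCast]
    ring
  rw [h1, mul_max_of_nonneg _ _ hs, ← natCast_mul_pow_eq]
  refine (mul_le_mul_of_nonneg_left (x.eval_add_le_max _ _) hp0.le).trans ?_
  rw [mul_max_of_nonneg _ _ hp0.le]
  refine max_le_max (by rw [eval_pow]) ?_
  rw [eval_mul, eval_C, norm_natCast_prime, mul_inv_cancel_left₀ hp0.ne', mul_assoc, eval_mul]
  refine mul_le_mul_of_nonneg_left ?_ hs
  rw [Finset.mul_sum]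
  refine x.eval_sum_le_of_le _ _ (by positivity) fun k hk => ?_
  rw [Finset.mem_Ioo] at hk
  rw [← mul_assoc, mul_comm]
  refine (x.eval_natCast_mul_le _ _).trans ?_
  rw [eval_mul, eval_mul, eval_pow, eval_pow, eval_C]
  calc ‖a‖ * (x.eval Y ^ (k - 1) * ‖a‖ ^ (p - k - 1)) ≤ r * (r ^ (k - 1) * r ^ (p - k - 1)) := by
        gcongr
    _ = r ^ (p - 1) := by
        rw [← pow_add, ← pow_succ']
        congr 1
        omega

variable {c : ℕ → ℂ_[p]}

/-- On the unit disk each factor has value at most 1 and varies by at most |x - a| / p because |c_j|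
≥ p. Ultrametrically the product varies no more than its factors. -/
theorem eval_prod_factor_sub_le (x : BerkovichLine p) (a : ℂ_[p])
    (hcp : ∀ j, (p : ℝ) ≤ ‖c j‖) (hx : x.eval X ≤ 1) (ha : ‖a‖ ≤ 1) (N : ℕ) :
    x.eval (∏ j ∈ Finset.range N, (1 - C (c j)⁻¹ * X) -
      ∏ j ∈ Finset.range N, C (1 - (c j)⁻¹ * a)) ≤ x.eval (X - C a) * (p : ℝ)⁻¹ := by
  have hp0 : (0 : ℝ) < p := by exact_mod_cast hp.out.pos
  have hp1 : (1 : ℝ) ≤ p := by exact_mod_cast hp.out.one_le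
  have hinv : ∀ j, ‖(c j)⁻¹‖ ≤ (p : ℝ)⁻¹ := fun j => by
    rw [norm_inv]
    exact inv_anti₀ hp0 (hcp j)
  have hinv1 : ∀ j, ‖(c j)⁻¹‖ ≤ 1 := fun j => (hinv j).trans (inv_le_one_of_one_le₀ hp1)
  have h := x.eval_prod_sub_prod_le (Finset.range N) (fun j => 1 - C (c j)⁻¹ * X)
    (fun j => C (1 - (c j)⁻¹ * a)) (B := fun _ => 1) (e := x.eval (X - C a) * (p : ℝ)⁻¹)
    (mul_nonneg (x.eval_nonneg _) (by positivity)) (fun j _ => ?_) (fun j _ => ?_) (fun j _ => ?_)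
  · simpa using h
  · refine (x.eval_sub_le_max _ _).trans (max_le x.eval_one.le ?_)
    rw [eval_mul, eval_C]
    exact mul_le_one₀ (hinv1 j) (x.eval_nonneg _) hx
  · rw [eval_C]
    rw [sub_eq_add_neg]
    refine (IsUltrametricDist.norm_add_le_max _ _).trans (max_le norm_one.le ?_)
    rw [norm_neg, norm_mul]
    exact mul_le_one₀ (hinv1 j) (norm_nonneg _) ha
  · have h1 : (1 - C (c j)⁻¹ * X - C (1 - (c j)⁻¹ * a) : ℂ_[p][X]) = C (c j)⁻¹ * (C a - X) := by
      rw [C_sub, C_1, C_mul]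
      ring
    rw [h1, eval_mul, eval_C, eval_sub_comm, mul_one, mul_comm]
    exact mul_le_mul_of_nonneg_left (hinv j) (x.eval_nonneg _)

theorem eval_prod_factor_le (x : BerkovichLine p) (hcp : ∀ j, (p : ℝ) ≤ ‖c j‖)
    (hx : x.eval X ≤ 1) (N : ℕ) :
    x.eval (∏ j ∈ Finset.range N, (1 - C (c j)⁻¹ * X)) ≤ 1 := by
  have hp0 : (0 : ℝ) < p := by exact_mod_cast hp.out.pos
  have hp1 : (1 : ℝ) ≤ p := by exact_mod_cast hp.out.one_le
  rw [eval_prod]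
  refine Finset.prod_le_one (fun j _ => x.eval_nonneg _) fun j _ => ?_
  refine (x.eval_sub_le_max _ _).trans (max_le x.eval_one.le ?_)
  rw [eval_mul, eval_C, norm_inv]
  exact mul_le_one₀ (inv_le_one_of_one_le₀ (hp1.trans (hcp j))) (x.eval_nonneg _) hx

/-- The contraction estimate on the disk of radius `ϱ`. -/
theorem map_eval_sub_le (hc : Tendsto (fun j => ‖c j‖) atTop atTop)
    (hcp : ∀ j, (p : ℝ) ≤ ‖c j‖) (hf : IsEntire (fc c)) (x : BerkovichLine p) {a : ℂ_[p]}
    (ha : ‖a‖ ≤ rho p) (hx : x.eval (X - C a) ≤ rho p) :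
    (map hf x).eval (X - C (fc c a)) ≤
      x.eval (X - C a) * max (p * x.eval (X - C a) ^ (p - 1)) (p : ℝ)⁻¹ := by
  have hp0 : (0 : ℝ) < p := by exact_mod_cast hp.out.pos
  have hrho := (rho_lt_one p).le
  have hrp : rho p ^ (p - 1) = (p : ℝ)⁻¹ := eq_inv_of_mul_eq_one_right (natCast_mul_rho_pow p)
  have hX : x.eval X ≤ 1 := by
    have := x.eval_X_sub_C_le a 0
    rw [C_0, sub_zero, sub_zero] at this
    exact this.trans (max_le (hx.trans hrho) (ha.trans hrho))
  have hs := x.eval_nonneg (X - C a)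
  refine le_of_tendsto' (tendsto_eval_partialPoly_sub hc hf x (tendsto_eval_partialPoly hc a))
    fun N => ?_
  set U : ℂ_[p][X] := ∏ j ∈ Finset.range N, (1 - C (c j)⁻¹ * X) with hU
  set V : ℂ_[p][X] := ∏ j ∈ Finset.range N, C (1 - (c j)⁻¹ * a) with hV
  -- Product rule: the first term varies z^p / p, the second varies the product of the remaining
  -- factors.
  have h1 : partialPoly c N - C ((partialPoly c N).eval a) =
      C (p : ℂ_[p])⁻¹ * (X ^ p - C (a ^ p)) * U + C (p : ℂ_[p])⁻¹ * C (a ^ p) * (U - V) := by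
    have hVe : C ((partialPoly c N).eval a) = C (p : ℂ_[p])⁻¹ * C (a ^ p) * V := by
      rw [hV, ← map_prod, partialPoly, Polynomial.eval_mul, Polynomial.eval_prod]
      simp
    rw [hVe, partialPoly, ← hU]
    ring
  rw [h1]
  refine (x.eval_add_le_max _ _).trans (max_le ?_ ?_)
  · rw [eval_mul, eval_mul, eval_C, norm_inv_natCast_prime]
    refine (mul_le_of_le_one_right (mul_nonneg hp0.le (x.eval_nonneg _))
      (x.eval_prod_factor_le hcp hX N)).trans ?_
    rw [← hrp]
    exact x.eval_pow_sub_le a ha hx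
  · rw [eval_mul, eval_mul, eval_C, eval_C, norm_inv_natCast_prime, norm_pow]
    have h2 : (p : ℝ) * ‖a‖ ^ p ≤ 1 := by
      calc (p : ℝ) * ‖a‖ ^ p ≤ p * rho p ^ p := by gcongr
        _ = rho p := by rw [natCast_mul_pow_eq, natCast_mul_rho_pow, mul_one]
        _ ≤ 1 := hrho
    calc _ ≤ 1 * (x.eval (X - C a) * (p : ℝ)⁻¹) :=
          mul_le_mul h2 (x.eval_prod_factor_sub_le a hcp hX (ha.trans hrho) N)
            (x.eval_nonneg _) zero_le_one
      _ ≤ _ := by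
          rw [one_mul]
          exact mul_le_mul_of_nonneg_left (le_max_right _ _) hs

/-- One ϱ bounds p |x|^p, the other bounds the distance of the remaining product from 1. Since ϱ² <
ϱ, the map reduces to z^p / p at ξ_{0,ϱ}. -/
theorem eval_partialPoly_sub_le (hcp : ∀ j, (p : ℝ) ≤ ‖c j‖) (x : BerkovichLine p)
    (hx : x.eval X ≤ rho p) (N : ℕ) :
    x.eval (partialPoly c N - C (p : ℂ_[p])⁻¹ * X ^ p) ≤ rho p * rho p := by
  have hp0 : (0 : ℝ) < p := by exact_mod_cast hp.out.pos
  have hp1 : (1 : ℝ) ≤ p := by exact_mod_cast hp.out.one_le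
  have h0 := x.eval_nonneg X
  have h1 := x.eval_prod_factor_sub_le (c := c) 0 hcp (hx.trans (rho_lt_one p).le) (by simp) N
  simp only [mul_zero, sub_zero, C_1, Finset.prod_const_one, C_0] at h1
  have h2 : partialPoly c N - C (p : ℂ_[p])⁻¹ * X ^ p =
      C (p : ℂ_[p])⁻¹ * X ^ p * (∏ j ∈ Finset.range N, (1 - C (c j)⁻¹ * X) - 1) := by
    rw [partialPoly]
    ring
  rw [h2, eval_mul, eval_mul, eval_C, norm_inv_natCast_prime, eval_pow]
  have h3 : (p : ℝ) * x.eval X ^ p ≤ rho p := by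
    calc (p : ℝ) * x.eval X ^ p ≤ p * rho p ^ p := by gcongr
      _ = rho p := by rw [natCast_mul_pow_eq, natCast_mul_rho_pow, mul_one]
  refine mul_le_mul h3 (h1.trans ?_) (x.eval_nonneg _) (rho_pos p).le
  exact (mul_le_of_le_one_right h0 (inv_le_one_of_one_le₀ hp1)).trans hx

theorem norm_fc_sub_lt (hc : Tendsto (fun j => ‖c j‖) atTop atTop) (hcp : ∀ j, (p : ℝ) ≤ ‖c j‖)
    {z : ℂ_[p]} (hz : ‖z‖ ≤ rho p) : ‖fc c z - (p : ℂ_[p])⁻¹ * z ^ p‖ < rho p := by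
  refine lt_of_le_of_lt (le_of_tendsto' ((tendsto_eval_partialPoly hc z).sub_const _).norm
    fun N => ?_) (mul_lt_of_lt_one_right (rho_pos p) (rho_lt_one p))
  have h := (classical z).eval_partialPoly_sub_le hcp (by simpa [classical_eval] using hz) N
  rwa [classical_eval, Polynomial.eval_sub, Polynomial.eval_mul, Polynomial.eval_C,
    Polynomial.eval_pow, Polynomial.eval_X] at h

/-- On the open unit disk, `|f_c(x)| = p |x| ^ p`. -/
theorem map_eval_X (hc : Tendsto (fun j => ‖c j‖) atTop atTop) (hcp : ∀ j, (p : ℝ) ≤ ‖c j‖)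
    (hf : IsEntire (fc c)) (x : BerkovichLine p) (hx : x.eval X < 1) :
    (map hf x).eval X = p * x.eval X ^ p := by
  have hp1 : (1 : ℝ) ≤ p := by exact_mod_cast hp.out.one_le
  have h0 : ∀ j, 0 < ‖c j‖ := fun j => one_pos.trans_le (hp1.trans (hcp j))
  refine tendsto_nhds_unique (tendsto_eval_partialPoly_zero hc hf x)
    (tendsto_const_nhds.congr fun N => ?_)
  rw [eval_partialPoly (fun j => norm_pos_iff.mp (h0 j)), Finset.prod_eq_one, mul_one]
  intro j _
  rw [eval_X_sub_C_of_lt x (hx.trans_le (hp1.trans (hcp j))), div_self (h0 j).ne']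

/-- A fixed point lies in the union of the blocks. -/
theorem exists_mem_of_map_eq (hc : Tendsto (fun j => ‖c j‖) atTop atTop) (h0 : ∀ j, c j ≠ 0)
    (hf : IsEntire (fc c)) (x : BerkovichLine p) (hx : map hf x = x) :
    x.eval X < 1 ∨ ∃ j, x.eval (X - C (c j)) < ‖c j‖ := by
  have hp1 : (1 : ℝ) < p := by exact_mod_cast hp.out.one_lt
  by_contra! h
  obtain ⟨h1, h2⟩ := h
  have h3 : (p : ℝ) * x.eval X ^ p ≤ (map hf x).eval X := by
    refine ge_of_tendsto' (tendsto_eval_partialPoly_zero hc hf x) fun N => ?_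
    rw [eval_partialPoly h0]
    refine le_mul_of_one_le_right (by positivity) ?_
    refine Finset.prod_induction _ (fun t : ℝ => 1 ≤ t)
      (fun a b => one_le_mul_of_one_le_of_one_le) le_rfl fun j _ => ?_
    exact (one_le_div (norm_pos_iff.mpr (h0 j))).mpr (h2 j)
  rw [hx] at h3
  have h4 : x.eval X ≤ x.eval X ^ p := le_self_pow₀ h1 hp.out.ne_zero
  nlinarith

theorem diskPoint_eval_X {r : ℝ} (hr : 0 < r) :
    (diskPoint (0 : ℂ_[p]) r hr).eval X = r := by
  have h := diskPoint_eval_X_sub_C (0 : ℂ_[p]) 0 hr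
  rwa [C_0, sub_zero, sub_zero, norm_zero, max_eq_right hr.le] at h

theorem eval_sub_eq_max_of_ne (x : BerkovichLine p) {a : ℂ_[p]} (h : ‖a‖ ≠ x.eval X) :
    x.eval (X - C a) = max ‖a‖ (x.eval X) := by
  rcases lt_or_gt_of_ne h with h | h
  · rw [eval_sub_eq_left x (by rwa [eval_C]), max_eq_right h.le]
  · rw [eval_X_sub_C_of_lt x h, max_eq_left h.le]

/-- The image has |x| = ϱ, so only centers with |a| = ϱ are in doubt. A value below ϱ there would
make z^p / p - a smaller than ϱ at ξ_{0,ϱ}, whereas its term of degree p alone contributes p ϱ^p =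
ϱ. -/
theorem map_diskPoint_rho (hc : Tendsto (fun j => ‖c j‖) atTop atTop)
    (hcp : ∀ j, (p : ℝ) ≤ ‖c j‖) (hf : IsEntire (fc c)) :
    map hf (diskPoint 0 (rho p) (rho_pos p)) = diskPoint 0 (rho p) (rho_pos p) := by
  have hp0 : (0 : ℝ) < p := by exact_mod_cast hp.out.pos
  set w := diskPoint (0 : ℂ_[p]) (rho p) (rho_pos p) with hw
  have hwX : w.eval X = rho p := diskPoint_eval_X _
  have hmX : (map hf w).eval X = rho p := by
    rw [map_eval_X hc hcp hf w (hwX ▸ rho_lt_one p), hwX, natCast_mul_pow_eq,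
      natCast_mul_rho_pow, mul_one]
  refine ext_linear fun a => ?_
  rw [hw, diskPoint_eval_X_sub_C, zero_sub, norm_neg, ← hw]
  by_cases ha : ‖a‖ = rho p
  · rw [ha, max_self]
    refine le_antisymm ?_ ?_
    · refine ((map hf w).eval_sub_le_max _ _).trans (max_le hmX.le ?_)
      rw [eval_C, ha]
    · by_contra! hlt
      obtain ⟨N, hN⟩ := ((tendsto_eval_partialPoly_sub hc hf w
        (tendsto_const_nhds (x := a))).eventually (gt_mem_nhds hlt)).exists
      have h1 := w.eval_partialPoly_sub_le hcp hwX.le N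
      have h2 : w.eval (C (p : ℂ_[p])⁻¹ * X ^ p - C a) < rho p := by
        refine (w.eval_sub_le_max_sub _ (partialPoly c N) _).trans_lt (max_lt ?_ hN)
        rw [eval_sub_comm]
        exact h1.trans_lt (mul_lt_of_lt_one_right (rho_pos p) (rho_lt_one p))
      have h3 : ‖(p : ℂ_[p])⁻¹‖ * rho p ^ p ≤ w.eval (C (p : ℂ_[p])⁻¹ * X ^ p - C a) := by
        have h4 := le_gaussNorm (NormedField.toAbsoluteValue ℂ_[p])
          (taylor 0 (C (p : ℂ_[p])⁻¹ * X ^ p - C a)) (rho_pos p).le p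
        rw [taylor_zero, coeff_sub, coeff_C_mul, coeff_X_pow_self, mul_one, coeff_C,
          if_neg hp.out.ne_zero, sub_zero] at h4
        rw [hw]
        change _ ≤ gaussNorm _ _ (taylor 0 _)
        rw [taylor_zero]
        exact h4
      rw [norm_inv_natCast_prime, natCast_mul_pow_eq, natCast_mul_rho_pow, mul_one] at h3
      exact h3.not_gt h2
  · rw [eval_sub_eq_max_of_ne _ (by rwa [hmX]), hmX]

/-- The fixed points in the open unit disk. -/
theorem isTypeI_or_eq_of_map_eq (hc : Tendsto (fun j => ‖c j‖) atTop atTop)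
    (hcp : ∀ j, (p : ℝ) ≤ ‖c j‖) (hf : IsEntire (fc c)) (x : BerkovichLine p)
    (hx : map hf x = x) (hx1 : x.eval X < 1) :
    x.eval X ≤ rho p ∧ (x.IsTypeI ∨ x = diskPoint 0 (rho p) (rho_pos p)) := by
  have hp1 : (1 : ℝ) < p := by exact_mod_cast hp.out.one_lt
  have h1 := map_eval_X hc hcp hf x hx1
  rw [hx] at h1
  rcases (x.eval_nonneg X).eq_or_lt with h0 | h0
  · exact ⟨h0 ▸ (rho_pos p).le, Or.inl ⟨0, eq_classical (by rw [C_0, sub_zero, ← h0])⟩⟩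
  have hr : x.eval X = rho p := eq_rho_of_natCast_mul_pow_eq h0 h1.symm
  refine ⟨hr.le, or_iff_not_imp_right.mpr fun hne => ?_⟩
  obtain ⟨a, ha⟩ : ∃ a, x.eval (X - C a) ≠
      (diskPoint (0 : ℂ_[p]) (rho p) (rho_pos p)).eval (X - C a) := by
    by_contra! h
    exact hne (ext_linear h)
  rw [diskPoint_eval_X_sub_C, zero_sub, norm_neg, ← hr] at ha
  have har : ‖a‖ = rho p := by
    by_contra h
    exact ha (x.eval_sub_eq_max_of_ne (by rwa [hr]))
  have hlt : x.eval (X - C a) < rho p := by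
    refine lt_of_le_of_ne ((x.eval_sub_le_max _ _).trans ?_) ?_
    · rw [eval_C, har, hr, max_self]
    · rwa [har, hr, max_self] at ha
  -- One contraction ratio valid for every center e with |e| ≤ ϱ that is at least as close to x as a
  -- is.
  set κ := max (p * x.eval (X - C a) ^ (p - 1)) (p : ℝ)⁻¹
  have hκ1 : κ < 1 :=
    max_lt (natCast_mul_pow_lt_one (x.eval_nonneg _) hlt) (inv_lt_one_of_one_lt₀ hp1)
  have hκ0 : 0 ≤ κ := le_max_of_le_right (by positivity)
  -- The centers are the iterates of a: as x is fixed, its distance to f_c(e) is at most κ times its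
  -- distance to e.
  have key : ∀ n : ℕ, ∃ e, ‖e‖ ≤ rho p ∧ x.eval (X - C e) ≤ κ ^ n * x.eval (X - C a) := by
    intro n
    induction n with
    | zero => exact ⟨a, har.le, by simp⟩
    | succ n ih =>
      obtain ⟨e, he, hex⟩ := ih
      have hea : x.eval (X - C e) ≤ x.eval (X - C a) :=
        hex.trans (mul_le_of_le_one_left (x.eval_nonneg _) (pow_le_one₀ hκ0 hκ1.le))
      have h2 := map_eval_sub_le hc hcp hf x he (hea.trans hlt.le)
      rw [hx] at h2
      have h3 : x.eval (X - C (fc c e)) ≤ κ * x.eval (X - C e) := by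
        rw [mul_comm]
        refine h2.trans (mul_le_mul_of_nonneg_left (max_le_max_right _ ?_) (x.eval_nonneg _))
        have := x.eval_nonneg (X - C e)
        gcongr
      have h4 : x.eval (X - C (fc c e)) ≤ κ ^ (n + 1) * x.eval (X - C a) := by
        rw [pow_succ', mul_assoc]
        exact h3.trans (mul_le_mul_of_nonneg_left hex hκ0)
      refine ⟨_, ((x.norm_le_max _).trans (max_le ?_ hr.le)), h4⟩
      exact (h4.trans (mul_le_of_le_one_left (x.eval_nonneg _)
        (pow_le_one₀ hκ0 hκ1.le))).trans hlt.le
  refine x.isTypeI_of_forall_exists fun n => ?_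
  have hlim : Tendsto (fun n : ℕ => κ ^ n * x.eval (X - C a)) atTop (𝓝 0) := by
    simpa using (tendsto_pow_atTop_nhds_zero_of_lt_one hκ0 hκ1).mul_const (x.eval (X - C a))
  obtain ⟨m, hm⟩ := (hlim.eventually (gt_mem_nhds
    (show 0 < 1 / ((n : ℝ) + 1) by positivity))).exists
  obtain ⟨e, -, he⟩ := key m
  exact ⟨e, he.trans hm.le⟩

/-- By the contraction estimate, f_c does not increase distances to z in the open disk of radius ϱ
around z. -/
theorem norm_multiplier_le_one (hc : Tendsto (fun j => ‖c j‖) atTop atTop)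
    (hcp : ∀ j, (p : ℝ) ≤ ‖c j‖) {z lam : ℂ_[p]} (hz : ‖z‖ ≤ rho p)
    (hlam : HasDerivAt (fc c) lam z) : ‖lam‖ ≤ 1 := by
  have hp1 : (1 : ℝ) ≤ p := by exact_mod_cast hp.out.one_le
  have hf := fc_isEntire hc
  refine hlam.le_of_lip' zero_le_one ?_
  filter_upwards [Metric.ball_mem_nhds z (rho_pos p)] with y hy
  rw [Metric.mem_ball, dist_eq_norm] at hy
  have h1 := map_eval_sub_le hc hcp hf (classical y) hz
    (by rw [classical_eval_X_sub_C]; exact hy.le)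
  rw [map_classical_eval, classical_eval_X_sub_C] at h1
  rw [one_mul]
  refine h1.trans (mul_le_of_le_one_right (norm_nonneg _) (max_le ?_ (inv_le_one_of_one_le₀ hp1)))
  exact (natCast_mul_pow_lt_one (norm_nonneg _) hy).le

/-- The tangent map at `ξ_{0,ϱ}` is the Frobenius morphism. -/
theorem tangentMapIsFrobenius_rho (hc : Tendsto (fun j => ‖c j‖) atTop atTop)
    (hcp : ∀ j, (p : ℝ) ≤ ‖c j‖) (hf : IsEntire (fc c)) :
    TangentMapIsFrobenius (map hf) (diskPoint 0 (rho p) (rho_pos p)) := by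
  have hp0 : (0 : ℝ) < p := by exact_mod_cast hp.out.pos
  have hp1 : (1 : ℝ) < p := by exact_mod_cast hp.out.one_lt
  obtain ⟨b, hbr, hbp⟩ := exists_norm_eq_rho p
  have hb : b ≠ 0 := norm_pos_iff.mp (hbr ▸ rho_pos p)
  have hfix := map_diskPoint_rho hc hcp hf
  have hpt : diskPoint (0 : ℂ_[p]) (rho p) (rho_pos p) =
      diskPoint 0 ‖b‖ (norm_pos_iff.mpr hb) := by
    simp only [hbr]
  refine ⟨hfix, tangentDisk 0 b, hpt ▸ isTangentCoordinate_tangentDisk 0 hb, fun t => ?_, ?_⟩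
  all_goals rw [hpt] at hfix ⊢
  · obtain ⟨w, rfl⟩ := IsLocalRing.residue_surjective t
    have hw : ‖(w : ℂ_[p])‖ ≤ 1 := (mem_padicComplexInt_iff _).mp w.2
    have hbw : ‖b * (w : ℂ_[p])‖ ≤ rho p := by
      rw [norm_mul, hbr]
      exact mul_le_of_le_one_right (rho_pos p).le hw
    refine isTangentImage_iff_of_mapsTo ((bijOn_tangentDisk 0 hb).mapsTo (Set.mem_univ _))
      (by rw [hfix]; exact (bijOn_tangentDisk 0 hb).mapsTo (Set.mem_univ _))
      (mem_closure_tangentDisk 0 hb _) univ_mem ?_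
    rintro x ⟨hx, -⟩
    rw [← map_pow, tangentDisk_residue 0 hb, zero_add, hbr]
    rw [tangentDisk_residue 0 hb, zero_add, mem_openDisk, hbr] at hx
    -- Here b^(p-1) = p turns (b w)^p / p into b w^p, so f_c(b w) lies in the direction of the
    -- residue of w^p; contraction carries the whole open disk along.
    have h1 : fc c (b * w) - b * ((w ^ p : 𝓞_ℂ_[p]) : ℂ_[p]) =
        fc c (b * w) - (p : ℂ_[p])⁻¹ * (b * w) ^ p := by
      have h2 : (p : ℂ_[p])⁻¹ * b ^ p = b := by
        have h : b ^ p = b ^ (p - 1) * b := by rw [← pow_succ, Nat.sub_add_cancel hp.out.one_le]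
        rw [h, hbp]
        rw [inv_mul_cancel_left₀]
        exact_mod_cast hp.out.ne_zero
      rw [mul_pow, ← mul_assoc, h2]
      rfl
    have h3 := norm_fc_sub_lt hc hcp hbw
    rw [← h1] at h3
    rw [← openDisk_congr h3, mem_openDisk]
    refine (map_eval_sub_le hc hcp hf x hbw hx.le).trans_lt (lt_of_le_of_lt ?_ hx)
    refine mul_le_of_le_one_right (x.eval_nonneg _) (max_le ?_ (inv_le_one_of_one_le₀ hp1.le))
    exact (natCast_mul_pow_lt_one (x.eval_nonneg _) hx).le
  -- A neighborhood is needed: the direction of infinity contains the zeros c_j, which leave it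
  -- under f_c. In the unit disk p |x|^p > ϱ as soon as |x| > ϱ.
  · refine isTangentImage_iff_of_mapsTo (U := openDisk 0 1)
      ((bijOn_tangentDisk 0 hb).mapsTo (Set.mem_univ _))
      (by rw [hfix]; exact (bijOn_tangentDisk 0 hb).mapsTo (Set.mem_univ _))
      (mem_closure_tangentDisk 0 hb _) ((isOpen_openDisk _ _).mem_nhds ?_) ?_
    · rw [mem_openDisk, C_0, sub_zero, diskPoint_eval_X, hbr]
      exact rho_lt_one p
    · rintro x ⟨hx, hx1⟩
      rw [mem_openDisk, C_0, sub_zero] at hx1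
      rw [mem_tangentDisk_infty, C_0, sub_zero, hbr] at hx ⊢
      rw [map_eval_X hc hcp hf x hx1, natCast_mul_pow_eq]
      have := one_lt_natCast_mul_pow hx
      nlinarith [rho_pos p]

theorem isTypeII_diskPoint_rho :
    IsTypeII (diskPoint (0 : ℂ_[p]) (rho p) (rho_pos p)) := by
  obtain ⟨b, hbr, -⟩ := exists_norm_eq_rho p
  exact ⟨0, b, norm_pos_iff.mp (hbr ▸ rho_pos p), by simp only [hbr]⟩

theorem not_isTypeI_diskPoint (a : ℂ_[p]) {r : ℝ} (hr : 0 < r) :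
    ¬ IsTypeI (diskPoint a r hr) := by
  rintro ⟨b, hb⟩
  have h := diskPoint_eval_X_sub_C a b hr
  rw [hb, classical_eval_X_sub_C, sub_self, norm_zero] at h
  exact (hr.trans_le (le_max_right _ _)).ne h

end BerkovichLine

end UnitDisk

/-! ### Taylor coefficients at varying centers and Weierstrass degrees -/

section LocalDegree

variable {p : ℕ} [hp : Fact p.Prime]

theorem HasFPowerSeriesOnBall.taylorCoeff_eq_coeff {f : ℂ_[p] → ℂ_[p]}
    {P : FormalMultilinearSeries ℂ_[p] ℂ_[p] ℂ_[p]} {a : ℂ_[p]}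
    (h : HasFPowerSeriesOnBall f P a ⊤) (n : ℕ) : taylorCoeff f a n = P.coeff n := by
  have h1 := h.factorial_smul 1 n
  rw [← iteratedDeriv_eq_iteratedFDeriv] at h1
  have h2 : (n.factorial : ℂ_[p]) ≠ 0 := by exact_mod_cast n.factorial_ne_zero
  rw [taylorCoeff, ← h1, FormalMultilinearSeries.coeff, nsmul_eq_mul, inv_mul_cancel_left₀ h2]
  rfl

theorem HasFPowerSeriesOnBall.changeOrigin_top {f : ℂ_[p] → ℂ_[p]}
    {P : FormalMultilinearSeries ℂ_[p] ℂ_[p] ℂ_[p]} {a : ℂ_[p]}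
    (h : HasFPowerSeriesOnBall f P a ⊤) (b : ℂ_[p]) :
    HasFPowerSeriesOnBall f (P.changeOrigin (b - a)) b ⊤ := by
  have h1 := h.changeOrigin (y := b - a) ENNReal.coe_lt_top
  rwa [add_sub_cancel, ENNReal.top_sub_coe] at h1

theorem IsEntire.exists_hasFPowerSeriesOnBall {f : ℂ_[p] → ℂ_[p]} (hf : IsEntire f) (a : ℂ_[p]) :
    ∃ P : FormalMultilinearSeries ℂ_[p] ℂ_[p] ℂ_[p], HasFPowerSeriesOnBall f P a ⊤ := by
  obtain ⟨P, hP⟩ := hf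
  exact ⟨_, hP.changeOrigin_top a⟩

theorem IsEntire.hasDerivAt {f : ℂ_[p] → ℂ_[p]} (hf : IsEntire f) (a : ℂ_[p]) :
    HasDerivAt f (taylorCoeff f a 1) a := by
  obtain ⟨P, hP⟩ := hf.exists_hasFPowerSeriesOnBall a
  rw [hP.taylorCoeff_eq_coeff]
  exact hP.hasFPowerSeriesAt.hasDerivAt

/-- Recentering a power series in a disk does not increase the terms on the boundary. -/
theorem IsEntire.norm_taylorCoeff_mul_pow_le {f : ℂ_[p] → ℂ_[p]} (hf : IsEntire f) {a b : ℂ_[p]}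
    {r B : ℝ} (hab : ‖b - a‖ ≤ r) {n : ℕ}
    (hB : ∀ m ≥ n, ‖taylorCoeff f a m‖ * r ^ m ≤ B) : ‖taylorCoeff f b n‖ * r ^ n ≤ B := by
  obtain ⟨P, hP⟩ := hf.exists_hasFPowerSeriesOnBall a
  have hr : 0 ≤ r := (norm_nonneg _).trans hab
  have hB0 : 0 ≤ B := (mul_nonneg (norm_nonneg _) (pow_nonneg hr n)).trans (hB n le_rfl)
  simp only [hP.taylorCoeff_eq_coeff] at hB
  rw [(hP.changeOrigin_top b).taylorCoeff_eq_coeff]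
  have hrad : P.radius = ⊤ := top_le_iff.mp hP.r_le
  have hsum : HasSum (fun l => P.changeOriginSeries n l (fun _ => b - a) 1)
      ((P.changeOrigin (b - a)).coeff n) := by
    have h1 := (P.hasFPowerSeriesOnBall_changeOrigin n (hrad ▸ ENNReal.zero_lt_top)).hasSum
      (y := b - a) (by simp [hrad])
    rw [zero_add] at h1
    exact ContinuousMultilinearMap.hasSum_eval h1 1
  rcases (pow_nonneg hr n).eq_or_lt with h0 | h0
  · rw [← h0, mul_zero]
    exact hB0
  rw [← le_div_iff₀ h0]
  refine le_of_tendsto' hsum.tendsto_sum_nat.norm fun L => ?_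
  have hq : 0 ≤ B / r ^ n := div_nonneg hB0 h0.le
  refine IsUltrametricDist.norm_sum_le_of_forall_le_of_nonneg hq fun l _ => ?_
  rw [FormalMultilinearSeries.changeOriginSeries, _root_.sum_apply,
    _root_.sum_apply]
  -- The index s accounts for the binomial multiplicity of the coefficient, to which the ultrametric
  -- bound is insensitive.
  refine IsUltrametricDist.norm_sum_le_of_forall_le_of_nonneg hq fun s _ => ?_
  have h2 := P.nnnorm_changeOriginSeriesTerm_apply_le n l s s.2 (b - a) 1
  rw [nnnorm_one, one_pow, mul_one, ← NNReal.coe_le_coe] at h2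
  rw [le_div_iff₀ h0]
  calc _ ≤ ‖P (n + l)‖ * ‖b - a‖ ^ l * r ^ n := mul_le_mul_of_nonneg_right h2 h0.le
    _ ≤ ‖P (n + l)‖ * r ^ l * r ^ n := by gcongr
    _ = ‖P.coeff (n + l)‖ * r ^ (n + l) := by
        rw [P.norm_apply_eq_norm_coef, pow_add]
        ring
    _ ≤ B := hB _ (Nat.le_add_right n l)

theorem IsEntire.tendsto_norm_taylorCoeff {f : ℂ_[p] → ℂ_[p]} (hf : IsEntire f) (a : ℂ_[p])
    {r : ℝ} (hr : 0 ≤ r) : Tendsto (fun n => ‖taylorCoeff f a n‖ * r ^ n) atTop (𝓝 0) := by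
  obtain ⟨P, hP⟩ := hf.exists_hasFPowerSeriesOnBall a
  have hrad : P.radius = ⊤ := top_le_iff.mp hP.r_le
  have h := P.summable_norm_mul_pow (r := ⟨r, hr⟩) (by rw [hrad]; exact ENNReal.coe_lt_top)
  refine h.tendsto_atTop_zero.congr fun n => ?_
  rw [hP.taylorCoeff_eq_coeff, P.norm_apply_eq_norm_coef]
  rfl

/-- Recentering does not increase the maximum of the terms of index at least n. Pass from b to a for
the indices at least 2, use that the linear term vanishes at a, and return to b: the linear term at
b is dominated by one of higher index. -/
theorem IsEntire.two_le_weierstrassDegree {f : ℂ_[p] → ℂ_[p]} (hf : IsEntire f) {a b : ℂ_[p]}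
    {r : ℝ} (hr : 0 < r) (hab : ‖b - a‖ ≤ r) (h1 : taylorCoeff f a 1 = 0) {m : ℕ} (hm : 1 ≤ m)
    (hfm : taylorCoeff f a m ≠ 0) : 2 ≤ weierstrassDegree f b r := by
  set u : ℂ_[p] → ℕ → ℝ := fun a n => ‖taylorCoeff f a n‖ * r ^ n with hu
  have hm2 : 2 ≤ m := by
    rcases hm.eq_or_lt with rfl | h
    · exact absurd h1 hfm
    · exact h
  -- the largest term at `b` of index at least two
  have hmax : ∃ n ≥ 2, 0 < u b n ∧ ∀ k ≥ 2, u b k ≤ u b n := by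
    have hpos : ∃ k ≥ 2, 0 < u b k := by
      by_contra! h
      have h2 : u a m ≤ 0 := hf.norm_taylorCoeff_mul_pow_le (a := b) (b := a)
        (by rwa [norm_sub_rev]) fun k hk => h k (hm2.trans hk)
      exact h2.not_gt (mul_pos (norm_pos_iff.mpr hfm) (pow_pos hr m))
    obtain ⟨k₀, hk₀, hpos⟩ := hpos
    obtain ⟨N, hN⟩ := eventually_atTop.mp
      ((hf.tendsto_norm_taylorCoeff b hr.le).eventually (gt_mem_nhds hpos))
    obtain ⟨n, hn, hmax⟩ := (Finset.Icc 2 (N + k₀)).exists_max_image (u b)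
      ⟨k₀, Finset.mem_Icc.mpr ⟨hk₀, by omega⟩⟩
    have hk₀n := hmax k₀ (Finset.mem_Icc.mpr ⟨hk₀, by omega⟩)
    refine ⟨n, (Finset.mem_Icc.mp hn).1, hpos.trans_le hk₀n, fun k hk => ?_⟩
    by_cases hkN : k ≤ N + k₀
    · exact hmax k (Finset.mem_Icc.mpr ⟨hk, hkN⟩)
    · exact (hN k (by omega)).le.trans hk₀n
  obtain ⟨n, hn, hpos, hmax⟩ := hmax
  have hone : u b 1 ≤ u b n := by
    refine hf.norm_taylorCoeff_mul_pow_le hab fun k hk => ?_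
    rcases Nat.eq_or_lt_of_le hk with rfl | hk
    · rw [h1, norm_zero, zero_mul]
      exact hpos.le
    · exact hf.norm_taylorCoeff_mul_pow_le (a := b) (b := a) (by rwa [norm_sub_rev])
        fun l hl => hmax l (le_trans hk hl)
  -- Boundedness has content: `sSup` of an unbounded set of naturals is 0.
  refine hn.trans (le_csSup ?_ ⟨by omega, fun k hk => ?_⟩)
  · obtain ⟨N, hN⟩ := eventually_atTop.mp
      ((hf.tendsto_norm_taylorCoeff b hr.le).eventually (gt_mem_nhds hpos))
    refine ⟨N, fun k hk => ?_⟩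
    by_contra! hlt
    exact (hk.2 n (by omega)).not_gt (hN k hlt.le)
  · rcases Nat.eq_or_lt_of_le hk with rfl | hk
    · exact hone
    · exact hmax k hk

end LocalDegree

/-! ### The maximum modulus and the expansion around the zeros c_j -/

section OuterDisks

variable {p : ℕ} [hp : Fact p.Prime]

theorem Polynomial.norm_eval_le_of_coeff_le {g : ℂ_[p][X]} {r B : ℝ} (hB0 : 0 ≤ B)
    (hB : ∀ i, ‖g.coeff i‖ * r ^ i ≤ B) {z : ℂ_[p]} (hz : ‖z‖ ≤ r) : ‖g.eval z‖ ≤ B := by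
  rw [Polynomial.eval_eq_sum_range]
  refine IsUltrametricDist.norm_sum_le_of_forall_le_of_nonneg hB0 fun i _ => ?_
  rw [norm_mul, norm_pow]
  exact (mul_le_mul_of_nonneg_left (pow_le_pow_left₀ (norm_nonneg z) hz i)
    (norm_nonneg _)).trans (hB i)

theorem exists_norm_fc_sub_partialPoly_le {c : ℕ → ℂ_[p]}
    (hc : Tendsto (fun j => ‖c j‖) atTop atTop) {r : ℝ} (hr : 0 < r) {ε : ℝ} (hε : 0 < ε) :
    ∃ N₀, ∀ N ≥ N₀, ∀ z : ℂ_[p], ‖z‖ ≤ r → ‖fc c z - (partialPoly c N).eval z‖ ≤ ε := by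
  obtain ⟨N₀, h₀⟩ := exists_norm_coeff_partialPoly_sub_le hc hr hε
  refine ⟨N₀, fun N hN z hz => ?_⟩
  refine le_of_tendsto ((tendsto_eval_partialPoly hc z).sub_const _).norm
    (eventually_atTop.mpr ⟨N, fun M hM => ?_⟩)
  rw [← Polynomial.eval_sub]
  exact norm_eval_le_of_coeff_le hε.le (fun i => by rw [coeff_sub]; exact h₀ N hN M hM i) hz

/-- The maximum modulus of `f_c` on the disk of radius `|c_j|`, from the absolute values of the
zeros of `f_c`. -/
noncomputable def zerosModulus (c : ℕ → ℂ_[p]) (j : ℕ) : ℝ :=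
  p * ‖c j‖ ^ p * ∏ i ∈ Finset.range j, (‖c j‖ / ‖c i‖)

/-- The quotient of `partialPoly c N` by its factor `1 - X / c_j`. -/
noncomputable def cofactorPoly (c : ℕ → ℂ_[p]) (j N : ℕ) : ℂ_[p][X] :=
  C (p : ℂ_[p])⁻¹ * X ^ p * ∏ i ∈ (Finset.range N).erase j, (1 - C (c i)⁻¹ * X)

theorem partialPoly_eq_cofactorPoly_mul {c : ℕ → ℂ_[p]} (h0 : ∀ i, c i ≠ 0) {j N : ℕ}
    (hN : j < N) : partialPoly c N = C (-(c j)⁻¹) * (cofactorPoly c j N * (X - C (c j))) := by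
  have h : (1 - C (c j)⁻¹ * X : ℂ_[p][X]) = C (-(c j)⁻¹) * (X - C (c j)) := by
    rw [mul_sub, ← C_mul, neg_mul, inv_mul_cancel₀ (h0 j), C_neg, C_neg, C_1]
    ring
  rw [partialPoly, cofactorPoly, ← Finset.mul_prod_erase _ _ (Finset.mem_range.mpr hN), h]
  ring

variable {c : ℕ → ℂ_[p]}

/-- The maximum with 1 is the sup-norm of the factor of index i on the disk of radius |c_j|; it
exceeds 1 only for the smaller zeros. -/
theorem prod_range_max_eq (h0 : ∀ i, c i ≠ 0) (hmono : StrictMono fun i => ‖c i‖) {j N : ℕ}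
    (hN : j < N) : ∏ i ∈ Finset.range N, max 1 (‖c j‖ / ‖c i‖) =
      ∏ i ∈ Finset.range j, (‖c j‖ / ‖c i‖) := by
  have hpos : ∀ i, 0 < ‖c i‖ := fun i => norm_pos_iff.mpr (h0 i)
  rw [← Finset.prod_subset (Finset.range_mono hN.le) fun i _ hi => ?_]
  · refine Finset.prod_congr rfl fun i hi => max_eq_right ?_
    exact (one_le_div (hpos i)).mpr (hmono (Finset.mem_range.mp hi)).le
  · exact max_eq_left ((div_le_one (hpos i)).mpr (hmono.monotone (by simpa using hi)))

theorem prod_erase_max_eq (h0 : ∀ i, c i ≠ 0) (hmono : StrictMono fun i => ‖c i‖) {j N : ℕ}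
    (hN : j < N) : ∏ i ∈ (Finset.range N).erase j, max 1 (‖c j‖ / ‖c i‖) =
      ∏ i ∈ Finset.range j, (‖c j‖ / ‖c i‖) := by
  rw [← prod_range_max_eq h0 hmono hN, Finset.prod_erase]
  rw [div_self (norm_ne_zero_iff.mpr (h0 j)), max_self]

theorem zerosModulus_pos (h0 : ∀ i, c i ≠ 0) (j : ℕ) : 0 < zerosModulus c j := by
  have hp0 : (0 : ℝ) < p := by exact_mod_cast hp.out.pos
  have hpos : ∀ i, 0 < ‖c i‖ := fun i => norm_pos_iff.mpr (h0 i)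
  exact mul_pos (mul_pos hp0 (pow_pos (hpos j) p))
    (Finset.prod_pos fun i _ => div_pos (hpos j) (hpos i))

/-- Makes the expansion factor φ(R_j) / R_j larger than 1. -/
theorem norm_lt_zerosModulus (hmono : StrictMono fun i => ‖c i‖) (h1 : ∀ i, 1 ≤ ‖c i‖) (j : ℕ) :
    ‖c j‖ < zerosModulus c j := by
  have hp1 : (1 : ℝ) < p := by exact_mod_cast hp.out.one_lt
  have hj : 0 < ‖c j‖ := one_pos.trans_le (h1 j)
  have h2 : (1 : ℝ) ≤ ∏ i ∈ Finset.range j, (‖c j‖ / ‖c i‖) :=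
    Finset.prod_induction _ (fun t : ℝ => 1 ≤ t)
      (fun a b => one_le_mul_of_one_le_of_one_le) le_rfl fun i hi =>
        (one_le_div (one_pos.trans_le (h1 i))).mpr (hmono (Finset.mem_range.mp hi)).le
  have h3 : ‖c j‖ ≤ ‖c j‖ ^ p := le_self_pow₀ (h1 j) hp.out.ne_zero
  calc ‖c j‖ < p * ‖c j‖ := by nlinarith
    _ ≤ p * ‖c j‖ ^ p := by gcongr
    _ ≤ _ := le_mul_of_one_le_right (by positivity) h2

/-- A root of X² - X + 1 satisfies u (1 - u) = 1, which forces both absolute values to be 1. This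
works for p = 2 too, where no integer reduces outside {0, 1}. -/
theorem exists_norm_eq_one_and_norm_sub_one_eq_one (p : ℕ) [Fact p.Prime] :
    ∃ u : ℂ_[p], ‖u‖ = 1 ∧ ‖u - 1‖ = 1 := by
  obtain ⟨u, hu⟩ := IsAlgClosed.exists_root (X ^ 2 - X + C 1 : ℂ_[p][X]) (by
    have h : (X ^ 2 - X + C 1 : ℂ_[p][X]).degree = 2 := by compute_degree!
    rw [h]
    decide)
  have hu1 : u * (1 - u) = 1 := by
    have h : u ^ 2 - u + 1 = 0 := by simpa using hu
    linear_combination -h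
  have hn : ‖u‖ * ‖u - 1‖ = 1 := by rw [norm_sub_rev, ← norm_mul, hu1, norm_one]
  have h1 : ‖u - 1‖ ≤ max ‖u‖ 1 := by
    have := IsUltrametricDist.norm_add_le_max u (-1)
    rwa [norm_neg, norm_one, ← sub_eq_add_neg] at this
  have h2 : ‖u‖ ≤ max ‖u - 1‖ 1 := by
    have := IsUltrametricDist.norm_add_le_max (u - 1) 1
    rwa [norm_one, sub_add_cancel] at this
  have hu0 := norm_nonneg u
  have hv0 := norm_nonneg (u - 1)
  have h3 : ‖u‖ ≤ 1 := by
    by_contra! h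
    have := (le_max_iff.mp h2).resolve_right h.not_ge
    nlinarith
  have h4 : ‖u - 1‖ ≤ 1 := by
    by_contra! h
    have := (le_max_iff.mp h1).resolve_right h.not_ge
    nlinarith
  exact ⟨u, le_antisymm h3 (by nlinarith), le_antisymm h4 (by nlinarith)⟩

/-- Each factor is bounded by its sup-norm. All bounds are attained at once at c_j u with |u| = |u -
1| = 1, a point of absolute value |c_j| at distance |c_j| from c_j. -/
theorem maxModulus_norm_eq (hc : Tendsto (fun j => ‖c j‖) atTop atTop) (h0 : ∀ i, c i ≠ 0)
    (hmono : StrictMono fun i => ‖c i‖) (j : ℕ) :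
    maxModulus (fc c) ‖c j‖ = zerosModulus c j := by
  have hp0 : (0 : ℝ) < p := by exact_mod_cast hp.out.pos
  have hpos : ∀ i, 0 < ‖c i‖ := fun i => norm_pos_iff.mpr (h0 i)
  have hnorm : ∀ z N, ‖(partialPoly c N).eval z‖ =
      p * ‖z‖ ^ p * ∏ i ∈ Finset.range N, (‖z - c i‖ / ‖c i‖) := fun z N => by
    have h := BerkovichLine.eval_partialPoly h0 (BerkovichLine.classical z) N
    simp only [BerkovichLine.classical_eval_X_sub_C] at h
    rwa [BerkovichLine.classical_eval, BerkovichLine.classical_eval, Polynomial.eval_X] at h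
  refine IsGreatest.csSup_eq ⟨?_, ?_⟩
  · obtain ⟨u, hu, hu1⟩ := exists_norm_eq_one_and_norm_sub_one_eq_one p
    have hz : ‖c j * u‖ = ‖c j‖ := by rw [norm_mul, hu, mul_one]
    refine ⟨c j * u, by simp [hz], ?_⟩
    refine tendsto_nhds_unique (tendsto_eval_partialPoly hc _).norm
      (tendsto_const_nhds.congr' ?_)
    filter_upwards [eventually_gt_atTop j] with N hN
    rw [hnorm, hz, zerosModulus, ← prod_range_max_eq h0 hmono hN]
    congr 1
    refine Finset.prod_congr rfl fun i _ => ?_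
    by_cases hij : i = j
    · subst hij
      have : c i * u - c i = c i * (u - 1) := by ring
      rw [this, norm_mul, hu1, mul_one, div_self (hpos i).ne', max_self]
    · have hne : ‖c i‖ ≠ ‖c j‖ := fun h => hij (hmono.injective h)
      have h := BerkovichLine.eval_sub_eq_max_of_ne (BerkovichLine.classical (c j * u))
        (a := c i) (by simpa [BerkovichLine.classical_eval, hu] using hne)
      rw [BerkovichLine.classical_eval_X_sub_C, BerkovichLine.classical_eval,
        Polynomial.eval_X, hz] at h
      rw [h, ← max_div_div_right (hpos i).le, div_self (hpos i).ne']
  · rintro _ ⟨z, hz, rfl⟩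
    rw [mem_closedBall_zero_iff] at hz
    refine le_of_tendsto (tendsto_eval_partialPoly hc z).norm ?_
    filter_upwards [eventually_gt_atTop j] with N hN
    rw [hnorm, zerosModulus, ← prod_range_max_eq h0 hmono hN]
    gcongr with i _
    rw [div_le_iff₀ (hpos i), max_mul_of_nonneg _ _ (hpos i).le, one_mul,
      div_mul_cancel₀ _ (hpos i).ne', max_comm]
    have h := IsUltrametricDist.norm_add_le_max z (-c i)
    rw [norm_neg, ← sub_eq_add_neg] at h
    exact h.trans (max_le_max_right _ hz)

namespace BerkovichLine

theorem eval_mul_sub_mul_le (x : BerkovichLine p) {g g' h h' : ℂ_[p][X]} {A B e : ℝ}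
    (he : 0 ≤ e) (hg : x.eval g ≤ A) (hh' : x.eval h' ≤ B) (hgg : x.eval (g - g') ≤ e * A)
    (hhh : x.eval (h - h') ≤ e * B) : x.eval (g * h - g' * h') ≤ e * (A * B) := by
  have hA : 0 ≤ A := (x.eval_nonneg _).trans hg
  have hid : g * h - g' * h' = g * (h - h') + (g - g') * h' := by ring
  rw [hid]
  refine (x.eval_add_le_max _ _).trans (max_le ?_ ?_)
  · rw [eval_mul]
    calc _ ≤ A * (e * B) := mul_le_mul hg hhh (x.eval_nonneg _) hA
      _ = _ := by ring
  · rw [eval_mul]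
    calc _ ≤ (e * A) * B := mul_le_mul hgg hh' (x.eval_nonneg _) (mul_nonneg he hA)
      _ = _ := by ring

theorem eval_factor_eq_max (h0 : ∀ i, c i ≠ 0) (hmono : StrictMono fun i => ‖c i‖) {j i : ℕ}
    (hij : i ≠ j) (x : BerkovichLine p) (hx : x.eval X = ‖c j‖) :
    x.eval (1 - C (c i)⁻¹ * X) = max 1 (‖c j‖ / ‖c i‖) := by
  have hpos : 0 < ‖c i‖ := norm_pos_iff.mpr (h0 i)
  rw [eval_factor x (h0 i), x.eval_sub_eq_max_of_ne
    (by rw [hx]; exact fun h => hij (hmono.injective h)), hx, ← max_div_div_right hpos.le,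
    div_self hpos.ne']

theorem eval_cofactorPoly (h0 : ∀ i, c i ≠ 0) (hmono : StrictMono fun i => ‖c i‖) {j N : ℕ}
    (hN : j < N) (x : BerkovichLine p) (hx : x.eval X = ‖c j‖) :
    x.eval (cofactorPoly c j N) = zerosModulus c j := by
  rw [cofactorPoly, zerosModulus, eval_mul, eval_mul, eval_C, norm_inv_natCast_prime, eval_pow, hx,
    eval_prod, ← prod_erase_max_eq h0 hmono hN]
  congr 1
  exact Finset.prod_congr rfl fun i hi =>
    eval_factor_eq_max h0 hmono (Finset.ne_of_mem_erase hi) x hx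

/-- Relative to its bound on |z| = |c_j|, each factor varies by at most |x - a| / |c_j|, and so does
the product. -/
theorem eval_cofactorPoly_sub_le (h0 : ∀ i, c i ≠ 0) (hmono : StrictMono fun i => ‖c i‖)
    {j N : ℕ} (hN : j < N) (x : BerkovichLine p) (hx : x.eval X = ‖c j‖) {a : ℂ_[p]}
    (ha : ‖a‖ = ‖c j‖) :
    x.eval (cofactorPoly c j N - C ((cofactorPoly c j N).eval a)) ≤
      x.eval (X - C a) / ‖c j‖ * zerosModulus c j := by
  have hpos : ∀ i, 0 < ‖c i‖ := fun i => norm_pos_iff.mpr (h0 i)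
  have haX : (classical a).eval X = ‖c j‖ := by rw [classical_eval, Polynomial.eval_X, ha]
  have he : 0 ≤ x.eval (X - C a) / ‖c j‖ := div_nonneg (x.eval_nonneg _) (hpos j).le
  have hC : C ((cofactorPoly c j N).eval a) = (C (p : ℂ_[p])⁻¹ * C a ^ p) *
      ∏ i ∈ (Finset.range N).erase j, C (1 - (c i)⁻¹ * a) := by
    rw [← map_prod, cofactorPoly, Polynomial.eval_mul, Polynomial.eval_prod]
    simp
  have hfac : ∀ i ∈ (Finset.range N).erase j, x.eval (C (1 - (c i)⁻¹ * a)) ≤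
      max 1 (‖c j‖ / ‖c i‖) := fun i hi => by
    have h := eval_factor_eq_max h0 hmono (Finset.ne_of_mem_erase hi) _ haX
    rw [classical_eval] at h
    rw [eval_C, ← h]
    simp
  rw [hC, zerosModulus, ← prod_erase_max_eq h0 hmono hN]
  refine x.eval_mul_sub_mul_le he ?_ ?_ ?_ ?_
  · rw [eval_mul, eval_C, norm_inv_natCast_prime, eval_pow, hx]
  · rw [eval_prod]
    exact Finset.prod_le_prod (fun i _ => x.eval_nonneg _) hfac
  · rw [← mul_sub, eval_mul, eval_C, norm_inv_natCast_prime, mul_left_comm]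
    refine mul_le_mul_of_nonneg_left ?_ (Nat.cast_nonneg _)
    have h := x.eval_prod_sub_prod_le (Finset.range p) (fun _ => X) (fun _ => C a)
      (B := fun _ => ‖c j‖) he (fun _ _ => hx.le) (fun _ _ => by rw [eval_C, ha])
      (fun _ _ => by rw [div_mul_cancel₀ _ (hpos j).ne'])
    simpa using h
  · refine x.eval_prod_sub_prod_le _ _ _ he (fun i hi => ?_) hfac fun i hi => ?_
    · exact (eval_factor_eq_max h0 hmono (Finset.ne_of_mem_erase hi) x hx).le
    · have h1 : (1 - C (c i)⁻¹ * X - C (1 - (c i)⁻¹ * a) : ℂ_[p][X]) = C (c i)⁻¹ * (C a - X) := by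
        rw [C_sub, C_1, C_mul]
        ring
      rw [h1, eval_mul, eval_C, eval_sub_comm, norm_inv]
      calc ‖c i‖⁻¹ * x.eval (X - C a) = x.eval (X - C a) / ‖c j‖ * (‖c j‖ / ‖c i‖) := by
            have := (hpos j).ne'
            field_simp
        _ ≤ _ := mul_le_mul_of_nonneg_left (le_max_right _ _) he

/-- The partial products expand the open disk of center `c_j` and radius `|c_j|`. -/
theorem eval_partialPoly_sub_eq (h0 : ∀ i, c i ≠ 0) (hmono : StrictMono fun i => ‖c i‖)
    {j N : ℕ} (hN : j < N) (x : BerkovichLine p) (hx : x.eval (X - C (c j)) < ‖c j‖) {a : ℂ_[p]}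
    (ha : ‖a - c j‖ < ‖c j‖) :
    x.eval (partialPoly c N - C ((partialPoly c N).eval a)) =
      zerosModulus c j / ‖c j‖ * x.eval (X - C a) := by
  have hpos : 0 < ‖c j‖ := norm_pos_iff.mpr (h0 j)
  have hxX := x.eval_X_of_lt hx
  have haX : ‖a‖ = ‖c j‖ := by
    have h := (classical a).eval_X_of_lt (a := c j) (by rwa [classical_eval_X_sub_C])
    rwa [classical_eval, Polynomial.eval_X] at h
  set q := cofactorPoly c j N
  -- The term q (X - a) dominates: the other is smaller by the factor |a - c_j| / |c_j| < 1.
  have h1 : partialPoly c N - C ((partialPoly c N).eval a) =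
      C (-(c j)⁻¹) * (q * (X - C a) + C (a - c j) * (q - C (q.eval a))) := by
    rw [partialPoly_eq_cofactorPoly_mul h0 hN]
    simp only [Polynomial.eval_mul, Polynomial.eval_C, Polynomial.eval_sub, Polynomial.eval_X,
      C_mul, C_sub]
    ring
  have hq := x.eval_cofactorPoly h0 hmono hN hxX
  have hqs := x.eval_cofactorPoly_sub_le h0 hmono hN hxX haX
  have hPhi := zerosModulus_pos h0 j
  rw [h1, eval_mul, eval_C, norm_neg, norm_inv]
  suffices h : x.eval (q * (X - C a) + C (a - c j) * (q - C (q.eval a))) =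
      zerosModulus c j * x.eval (X - C a) by
    rw [h]
    field_simp
  -- Strict domination requires |x - a| > 0; otherwise both terms vanish.
  rcases (x.eval_nonneg (X - C a)).eq_or_lt with ht | ht
  · rw [← ht, zero_div, zero_mul] at hqs
    rw [← ht, mul_zero]
    refine le_antisymm ((x.eval_add_le_max _ _).trans (max_le ?_ ?_)) (x.eval_nonneg _)
    · rw [eval_mul, ← ht, mul_zero]
    · rw [eval_mul]
      exact mul_nonpos_of_nonneg_of_nonpos (x.eval_nonneg _) hqs
  · rw [eval_add_eq_left, eval_mul, hq]
    rw [eval_mul, eval_mul, eval_C, hq]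
    calc _ ≤ ‖a - c j‖ * (x.eval (X - C a) / ‖c j‖ * zerosModulus c j) :=
          mul_le_mul_of_nonneg_left hqs (norm_nonneg _)
      _ < ‖c j‖ * (x.eval (X - C a) / ‖c j‖ * zerosModulus c j) := by gcongr
      _ = _ := by field_simp

/-- The map `f_c` expands the open disk of center `c_j` and radius `|c_j|`. -/
theorem map_eval_sub_eq (hc : Tendsto (fun j => ‖c j‖) atTop atTop) (h0 : ∀ i, c i ≠ 0)
    (hmono : StrictMono fun i => ‖c i‖) (hf : IsEntire (fc c)) {j : ℕ} (x : BerkovichLine p)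
    (hx : x.eval (X - C (c j)) < ‖c j‖) {a : ℂ_[p]} (ha : ‖a - c j‖ < ‖c j‖) :
    (map hf x).eval (X - C (fc c a)) = zerosModulus c j / ‖c j‖ * x.eval (X - C a) := by
  refine tendsto_nhds_unique
    (tendsto_eval_partialPoly_sub hc hf x (tendsto_eval_partialPoly hc a))
    (tendsto_const_nhds.congr' ?_)
  filter_upwards [eventually_gt_atTop j] with N hN
  exact (x.eval_partialPoly_sub_eq h0 hmono hN hx ha).symm

/-- A polynomial that is larger at `ξ_{e,t}` than at `e` has a root in the open disk. -/
theorem exists_root_of_norm_eval_lt {g : ℂ_[p][X]} {e : ℂ_[p]} {t : ℝ} (ht : 0 < t)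
    (h : ‖g.eval e‖ < (diskPoint e t ht).eval g) : ∃ z, g.IsRoot z ∧ ‖z - e‖ < t := by
  by_contra! hno
  refine h.ne ?_
  rw [← classical_eval, eval_eq_prod_roots, eval_eq_prod_roots (diskPoint e t ht)]
  congr 2
  refine Multiset.map_congr rfl fun z hz => ?_
  rw [diskPoint_eval_X_sub_C, classical_eval_X_sub_C, max_eq_left]
  rw [norm_sub_rev]
  exact hno z (isRoot_of_mem_roots hz)

theorem norm_fc_sub_eq (hc : Tendsto (fun j => ‖c j‖) atTop atTop) (h0 : ∀ i, c i ≠ 0)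
    (hmono : StrictMono fun i => ‖c i‖) {j : ℕ} {y z : ℂ_[p]} (hy : ‖y - c j‖ < ‖c j‖)
    (hz : ‖z - c j‖ < ‖c j‖) :
    ‖fc c y - fc c z‖ = zerosModulus c j / ‖c j‖ * ‖y - z‖ := by
  have h := (classical y).map_eval_sub_eq hc h0 hmono (fc_isEntire hc) (j := j)
    (by rwa [classical_eval_X_sub_C]) hz
  rwa [map_classical_eval, classical_eval_X_sub_C] at h

theorem exists_fixedPoint_partialPoly (h0 : ∀ i, c i ≠ 0) (hmono : StrictMono fun i => ‖c i‖)
    (h1 : ∀ i, 1 ≤ ‖c i‖) {j N : ℕ} (hN : j < N) :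
    ∃ z, ‖z - c j‖ < ‖c j‖ ∧ (partialPoly c N).eval z = z := by
  have hpos : 0 < ‖c j‖ := norm_pos_iff.mpr (h0 j)
  have hPhi := zerosModulus_pos h0 j
  have hlt := norm_lt_zerosModulus hmono h1 j
  -- The lower bound says that the expansion factor times t exceeds |c_j|. So P_N - X is larger at
  -- ξ_{c_j,t} than at c_j, where its value is |c_j|, and it has a root nearby.
  obtain ⟨t, ht1, ht2⟩ : ∃ t, ‖c j‖ * ‖c j‖ / zerosModulus c j < t ∧ t < ‖c j‖ := by
    refine exists_between ?_
    rw [div_lt_iff₀ hPhi]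
    gcongr
  have ht : 0 < t := lt_trans (by positivity) ht1
  rw [div_lt_iff₀ hPhi] at ht1
  have hP0 : (partialPoly c N).eval (c j) = 0 := by
    rw [partialPoly_eq_cofactorPoly_mul h0 hN]
    simp
  have hx : (diskPoint (c j) t ht).eval (X - C (c j)) = t := by
    rw [diskPoint_eval_X_sub_C, sub_self, norm_zero, max_eq_right ht.le]
  have h2 := (diskPoint (c j) t ht).eval_partialPoly_sub_eq h0 hmono hN (hx.trans_lt ht2)
    (a := c j) (by simpa using hpos)
  rw [hP0, C_0, sub_zero, hx] at h2
  have h3 := (diskPoint (c j) t ht).eval_X_of_lt (hx.trans_lt ht2)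
  have h4 : ‖c j‖ < zerosModulus c j / ‖c j‖ * t := by
    rw [div_mul_eq_mul_div, lt_div_iff₀ hpos, mul_comm _ t]
    exact ht1
  obtain ⟨z, hz, hzt⟩ := exists_root_of_norm_eval_lt (g := partialPoly c N - X) ht (by
    rw [eval_sub_eq_left _ (by rw [h2, h3]; exact h4), h2, Polynomial.eval_sub, hP0,
      Polynomial.eval_X, zero_sub, norm_neg]
    exact h4)
  refine ⟨z, hzt.trans ht2, ?_⟩
  rw [IsRoot.def, Polynomial.eval_sub, Polynomial.eval_X, sub_eq_zero] at hz
  exact hz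

/-- Fixed points of the partial products are approximate fixed points of f_c, and expansion makes
them a Cauchy sequence. The limit stays in the open disk, which is also closed. -/
theorem exists_fixedPoint (hc : Tendsto (fun j => ‖c j‖) atTop atTop) (h0 : ∀ i, c i ≠ 0)
    (hmono : StrictMono fun i => ‖c i‖) (h1 : ∀ i, 1 ≤ ‖c i‖) (j : ℕ) :
    ∃ z, ‖z - c j‖ < ‖c j‖ ∧ fc c z = z := by
  have hpos : 0 < ‖c j‖ := norm_pos_iff.mpr (h0 j)
  have hK : 1 < zerosModulus c j / ‖c j‖ :=
    (one_lt_div hpos).mpr (norm_lt_zerosModulus hmono h1 j)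
  have hex : ∀ n : ℕ, ∃ z, ‖z - c j‖ < ‖c j‖ ∧ ‖fc c z - z‖ ≤ 1 / ((n : ℝ) + 1) := fun n => by
    obtain ⟨N₀, h₀⟩ := exists_norm_fc_sub_partialPoly_le hc hpos
      (show 0 < 1 / ((n : ℝ) + 1) by positivity)
    obtain ⟨z, hz, hfix⟩ := exists_fixedPoint_partialPoly h0 hmono h1
      (show j < max N₀ (j + 1) from lt_max_of_lt_right (Nat.lt_succ_self j))
    refine ⟨z, hz, ?_⟩
    have h := h₀ _ (le_max_left N₀ (j + 1)) z (by
      have := IsUltrametricDist.norm_add_le_max (z - c j) (c j)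
      rw [sub_add_cancel] at this
      exact this.trans (max_le hz.le le_rfl))
    rwa [hfix] at h
  choose z hz hfz using hex
  -- Were the two points farther apart than their errors, f_c would not increase their distance,
  -- contrary to expansion.
  have hdist : ∀ m n, m ≤ n → ‖z n - z m‖ ≤ 1 / ((m : ℝ) + 1) := fun m n hmn => by
    have h2 := norm_fc_sub_eq hc h0 hmono (hz n) (hz m)
    by_contra! hlt
    have h3 : ‖fc c (z n) - fc c (z m)‖ ≤ ‖z n - z m‖ := by
      have hid : fc c (z n) - fc c (z m) =
          (fc c (z n) - z n) + ((z n - z m) + -(fc c (z m) - z m)) := by ring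
      rw [hid]
      refine (IsUltrametricDist.norm_add_le_max _ _).trans (max_le ?_
        ((IsUltrametricDist.norm_add_le_max _ _).trans (max_le le_rfl ?_)))
      · refine (hfz n).trans (le_trans ?_ hlt.le)
        gcongr
      · rw [norm_neg]
        exact (hfz m).trans hlt.le
    have h4 : 0 < ‖z n - z m‖ := lt_trans (by positivity) hlt
    nlinarith
  have hlim := tendsto_one_div_add_atTop_nhds_zero_nat (𝕜 := ℝ)
  have hcau : CauchySeq z := by
    refine Metric.cauchySeq_iff'.mpr fun ε hε => ?_
    obtain ⟨N, hN⟩ := (hlim.eventually (gt_mem_nhds hε)).exists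
    exact ⟨N, fun n hn => by rw [dist_eq_norm]; exact (hdist N n hn).trans_lt hN⟩
  obtain ⟨w, hw⟩ := cauchySeq_tendsto_of_complete hcau
  have hwm : ‖w - c j‖ < ‖c j‖ := by
    obtain ⟨n, hn⟩ := ((tendsto_iff_norm_sub_tendsto_zero.mp hw).eventually
      (gt_mem_nhds hpos)).exists
    have h2 := IsUltrametricDist.norm_add_le_max (w - z n) (z n - c j)
    rw [sub_add_sub_cancel, norm_sub_rev w (z n)] at h2
    exact h2.trans_lt (max_lt hn (hz n))
  refine ⟨w, hwm, ?_⟩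
  have hfw : Tendsto (fun n => fc c (z n)) atTop (𝓝 (fc c w)) :=
    ((fc_isEntire hc).hasDerivAt w).continuousAt.tendsto.comp hw
  have h5 : Tendsto (fun n => fc c (z n) - z n) atTop (𝓝 0) :=
    squeeze_zero_norm hfz hlim
  exact sub_eq_zero.mp (tendsto_nhds_unique (hfw.sub hw) h5)

theorem norm_multiplier_eq (hc : Tendsto (fun j => ‖c j‖) atTop atTop) (h0 : ∀ i, c i ≠ 0)
    (hmono : StrictMono fun i => ‖c i‖) {j : ℕ} {z lam : ℂ_[p]} (hz : ‖z - c j‖ < ‖c j‖)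
    (hlam : HasDerivAt (fc c) lam z) : ‖lam‖ = zerosModulus c j / ‖c j‖ := by
  refine tendsto_nhds_unique (hasDerivAt_iff_tendsto_slope.mp hlam).norm
    (tendsto_const_nhds.congr' ?_)
  have hball : ∀ᶠ y in 𝓝[≠] z, y ∈ Metric.ball (c j) ‖c j‖ :=
    nhdsWithin_le_nhds (Metric.isOpen_ball.mem_nhds (by rwa [Metric.mem_ball, dist_eq_norm]))
  filter_upwards [hball, self_mem_nhdsWithin] with y hy hyz
  rw [Metric.mem_ball, dist_eq_norm] at hy
  rw [slope_def_field, norm_div, norm_fc_sub_eq hc h0 hmono hy hz,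
    mul_div_cancel_right₀ _ (norm_ne_zero_iff.mpr (sub_ne_zero.mpr hyz))]

end BerkovichLine

end OuterDisks

/-! ### The local degree at ξ_{0,ϱ} -/

section LocalDegreeAtGaussPoint

variable {p : ℕ} [hp : Fact p.Prime]

theorem taylorCoeff_fc_one {c : ℕ → ℂ_[p]} (hc : Tendsto (fun j => ‖c j‖) atTop atTop) :
    taylorCoeff (fc c) 0 1 = 0 := by
  refine tendsto_nhds_unique (tendsto_coeff_partialPoly hc 1) (tendsto_const_nhds.congr fun N => ?_)
  rw [partialPoly, mul_assoc, coeff_C_mul, coeff_X_pow_mul', if_neg (not_le.mpr hp.out.one_lt),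
    mul_zero]

theorem taylorCoeff_fc_prime {c : ℕ → ℂ_[p]} (hc : Tendsto (fun j => ‖c j‖) atTop atTop) :
    taylorCoeff (fc c) 0 p = (p : ℂ_[p])⁻¹ := by
  refine tendsto_nhds_unique (tendsto_coeff_partialPoly hc p) (tendsto_const_nhds.congr fun N => ?_)
  rw [partialPoly, mul_assoc, coeff_C_mul, coeff_X_pow_mul', if_pos le_rfl, Nat.sub_self,
    coeff_zero_eq_eval_zero, Polynomial.eval_prod]
  simp

/-- Every closed disk that contains ξ_{0,ρ} contains 0, where f_c has no linear term but a nonzero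
term of degree p. -/
theorem BerkovichLine.two_le_localDegree_diskPoint {c : ℕ → ℂ_[p]}
    (hc : Tendsto (fun j => ‖c j‖) atTop atTop) {ρ : ℝ} (hρ : 0 < ρ) :
    2 ≤ localDegree (fc c) (diskPoint 0 ρ hρ) := by
  refine le_csInf ⟨_, 0, ρ, hρ, ?_, rfl⟩ ?_
  · rw [diskPoint_eval_X_sub_C, sub_self, norm_zero, max_eq_right hρ.le]
  · rintro _ ⟨a, r, hr, ha, rfl⟩
    rw [diskPoint_eval_X_sub_C, norm_sub_rev] at ha
    refine (fc_isEntire hc).two_le_weierstrassDegree hr ((le_max_left _ _).trans ha)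
      (taylorCoeff_fc_one hc) hp.out.one_le ?_
    rw [taylorCoeff_fc_prime hc]
    exact inv_ne_zero (by exact_mod_cast hp.out.ne_zero)

end LocalDegreeAtGaussPoint

/-! ### Assembly of the three statements -/

theorem propositionp (p : ℕ) [Fact p.Prime] (R : ℕ → ℝ) (hmono : StrictMono R)
    (hlim : Tendsto R atTop atTop) (hR : (p : ℝ) < R 0)
    (c : ℕ → ℂ_[p]) (hc : c ∈ paramSpace p R) :
    ∃ hf : IsEntire (fc c),
    (∀ x : BerkovichLine p, BerkovichLine.map hf x = x → ∃ j, x ∈ block c R j) ∧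
    (BerkovichLine.diskPoint 0 (rho p) (rho_pos p) ∈ block c R 0 ∧
      (∀ x ∈ block c R 0, BerkovichLine.IsRepellingFixedPoint hf x ↔
        x = BerkovichLine.diskPoint 0 (rho p) (rho_pos p)) ∧
      BerkovichLine.IsTypeII (BerkovichLine.diskPoint (0 : ℂ_[p]) (rho p) (rho_pos p)) ∧
      BerkovichLine.TangentMapIsFrobenius (BerkovichLine.map hf)
        (BerkovichLine.diskPoint 0 (rho p) (rho_pos p))) ∧
    ∀ j, ∃ w ∈ block c R (j + 1),
      (∀ x ∈ block c R (j + 1), BerkovichLine.map hf x = x ↔ x = w) ∧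
      BerkovichLine.IsRepellingFixedPoint hf w ∧
      ∃ z lam : ℂ_[p], w = BerkovichLine.classical z ∧ HasDerivAt (fc c) lam z ∧
        ‖lam‖ = maxModulus (fc c) (R j) / R j := by
  have hnorm : ∀ j, ‖c j‖ = R j := hc
  have hct : Tendsto (fun j => ‖c j‖) atTop atTop := tendsto_norm_of_mem_paramSpace hlim hc
  have hcm : StrictMono fun j => ‖c j‖ := by
    simp only [hnorm]
    exact hmono
  have hcp : ∀ j, (p : ℝ) ≤ ‖c j‖ := fun j => by
    rw [hnorm]
    exact hR.le.trans (hmono.monotone (Nat.zero_le j))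
  have hp1 : (1 : ℝ) ≤ p := by exact_mod_cast (Fact.out : p.Prime).one_le
  have hc1 : ∀ j, 1 ≤ ‖c j‖ := fun j => hp1.trans (hcp j)
  have hc0 : ∀ j, c j ≠ 0 := fun j => norm_pos_iff.mp (one_pos.trans_le (hc1 j))
  have hf : IsEntire (fc c) := fc_isEntire hct
  have hblock : ∀ x, x ∈ block c R 0 ↔ x.eval X < 1 := fun x => by
    change x.eval (X - C 0) < 1 ↔ _
    rw [C_0, sub_zero]
  refine ⟨hf, fun x hx => ?_, ⟨?_, fun x hx => ⟨?_, ?_⟩, BerkovichLine.isTypeII_diskPoint_rho,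
    BerkovichLine.tangentMapIsFrobenius_rho hct hcp hf⟩, fun j => ?_⟩
  · rcases BerkovichLine.exists_mem_of_map_eq hct hc0 hf x hx with h | ⟨j, hj⟩
    · exact ⟨0, (hblock x).mpr h⟩
    · exact ⟨j + 1, hj.trans_eq (hnorm j)⟩
  · rw [hblock, BerkovichLine.diskPoint_eval_X]
    exact rho_lt_one p
  · rintro ⟨hfix, hrep⟩
    obtain ⟨hle, h⟩ := BerkovichLine.isTypeI_or_eq_of_map_eq hct hcp hf x hfix ((hblock x).mp hx)
    -- A type I fixed point here has |z| ≤ ϱ, so its multiplier is too small; a fixed point of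
    -- another type can only be ξ_{0,ϱ}.
    rcases hrep with ⟨z, lam, rfl, hlam, hgt⟩ | ⟨hnot, -⟩
    · rw [BerkovichLine.classical_eval, Polynomial.eval_X] at hle
      exact absurd (BerkovichLine.norm_multiplier_le_one hct hcp hle hlam) (not_le.mpr hgt)
    · exact h.resolve_left hnot
  · rintro rfl
    exact ⟨BerkovichLine.map_diskPoint_rho hct hcp hf, Or.inr
      ⟨BerkovichLine.not_isTypeI_diskPoint _ _, BerkovichLine.two_le_localDegree_diskPoint hct _⟩⟩
  · obtain ⟨z, hz, hfz⟩ := BerkovichLine.exists_fixedPoint hct hc0 hcm hc1 j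
    have hK : 1 < zerosModulus c j / ‖c j‖ :=
      (one_lt_div (one_pos.trans_le (hc1 j))).mpr (norm_lt_zerosModulus hcm hc1 j)
    have hmem : ∀ x, x ∈ block c R (j + 1) ↔ x.eval (X - C (c j)) < ‖c j‖ := fun x => by
      rw [hnorm]
      exact Iff.rfl
    have hfix : BerkovichLine.map hf (BerkovichLine.classical z) = BerkovichLine.classical z := by
      rw [BerkovichLine.map_classical, hfz]
    have hder := hf.hasDerivAt z
    have hlam := BerkovichLine.norm_multiplier_eq hct hc0 hcm hz hder
    refine ⟨BerkovichLine.classical z, ?_, fun x hx => ⟨fun hxf => ?_, ?_⟩,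
      ⟨hfix, Or.inl ⟨z, _, rfl, hder, hlam ▸ hK⟩⟩, z, _, rfl, hder, ?_⟩
    · rwa [hmem, BerkovichLine.classical_eval_X_sub_C]
    · have h := x.map_eval_sub_eq hct hc0 hcm hf ((hmem x).mp hx) hz
      rw [hxf, hfz] at h
      refine BerkovichLine.eq_classical ?_
      -- The distance from x to z equals itself times a factor larger than 1, so it is 0.
      nlinarith [x.eval_nonneg (X - C z)]
    · rintro rfl
      exact hfix
    · rw [hlam, ← hnorm, maxModulus_norm_eq hct hc0 hcm]
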